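/- A \emph{measured weighted graph} $G=(V,w,m)$ consists of a countable set $V$, a symmetric function $w\colon V\times V\to[0,\infty)$ vanishing on the diagonal and a function $m\colon V\to(0,\infty)$. Write $x\sim y$ if $w(x,y)>0$. We assume that $G$ is connected and locally finite (every $x$ has finitely many neighbours $y\sim x$). Put $q(x,y)=w(x,y)/m(x)$, $\operatorname{Deg}_{\max}=\sup_x\sum_y q(x,y)$ and $$\Delta f(x)=\sum_{y}q(x,y)(f(y)-f(x)),\qquad L=-\Delta,\qquad P_t=e^{t\Delta}\quad(t\ge 0),$$ $$\Gamma(f,g)=\tfrac12\big(\Delta(fg)-f\Delta g-g\Delta f\big),\qquad \Gamma_2(f,g)=\tfrac12\big(\Delta\Gamma(f,g)-\Gamma(f,\Delta g)-\Gamma(g,\Delta f)\big).$$ For $\rho\colon V\to\mathbb R$, $G$ satisfies $CD(\rho,\infty)$ if $\Gamma_2(f,f)(x)\ge\rho(x)\,\Gamma(f,f)(x)$ for all bounded $f\colon V\to\mathbb R$ and all $x\in V$. For $T>0$ and $W\colon V\to[0,\infty)$ let $$k_T(W)=\sup_{n\in\mathbb N}\int_0^T\|P_t(n\wedge W)\|_\infty\,dt,$$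 and write $a_-=-\min\{0,a\}$ for $a\in\mathbb R$. Let $\lambda_1$ be the first positive eigenvalue of $L$ in $L^2(V,m)$, and let $$h=\inf\Big\{\frac{|\partial U|}{\operatorname{vol}U}\ :\ \emptyset\ne U\subset V,\ \operatorname{vol}U<\infty,\ \operatorname{vol}U\le\tfrac12\operatorname{vol}V\Big\},\qquad |\partial U|=\sum_{x\in U,\,y\notin U}w(x,y),\quad \operatorname{vol}U=\sum_{x\in U}m(x),$$ be the Cheeger constant (if $\lambda_1$ or $h$ is an infimum over the empty set, as for a single vertex, its value is $+\infty$). \textbf{Theorem (Buser inequality).} Let $K,T>0$, let $G$ be a measured weighted graph with $\operatorname{Deg}_{\max}<\infty$, and let $\rho\colon V\to\mathbb R$ be such that $G$ satisfies $CD(\rho,\infty)$ and $$k_T\big((\rho-K)_-\big)<\tfrac14\big(1-e^{-KT/2}\big).$$ Then there is a constant $c>0$ depending only on $K$, $T$ and $\inf_{x\sim y}\frac{w(x,y)}{m(x)}$ such that $$\lambda_1\le c\,h^2.$$ -/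

import Mathlib

open scoped ENNReal

/-- A measured and weighted graph `(V, w, m)`, locally finite and connected. -/
structure MWG (V : Type*) where
  w : V → V → ℝ
  m : V → ℝ
  w_nonneg : ∀ x y, 0 ≤ w x y
  w_symm : ∀ x y, w x y = w y x
  w_diag : ∀ x, w x x = 0
  m_pos : ∀ x, 0 < m x
  locally_finite : ∀ x, {y | 0 < w x y}.Finite
  connected : ∀ x y, Relation.ReflTransGen (fun a b => 0 < w a b) x y

namespace MWG

noncomputable section

variable {V : Type*} (G : MWG V)

/-- The finite set of neighbours of `x`. -/
def nbr (x : V) : Finset V := (G.locally_finite x).toFinset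

/-- `q(x,y) = w(x,y) / m(x)`. -/
def q (x y : V) : ℝ := G.w x y / G.m x

/-- `Deg(x) = ∑_y q(x,y)`; the terms outside `nbr x` vanish. -/
def deg (x : V) : ℝ := ∑ y ∈ G.nbr x, G.q x y

/-- `Deg_max = sup_x Deg(x)`. -/
def degMax : ℝ≥0∞ := ⨆ x, ENNReal.ofReal (G.deg x)

/-- `inf_{x ∼ y} w(x,y) / m(x)`, over all ordered pairs of neighbours. -/
def qInf : ℝ≥0∞ := ⨅ (x : V) (y : V) (_ : 0 < G.w x y), ENNReal.ofReal (G.q x y)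

/-- The Laplacian `Δ f(x) = ∑_y q(x,y) (f(y) - f(x))`; the terms outside `nbr x` vanish. -/
def lap (f : V → ℝ) (x : V) : ℝ := ∑ y ∈ G.nbr x, G.q x y * (f y - f x)

/-- The carré du champ operator. -/
def Γ (f g : V → ℝ) (x : V) : ℝ :=
  (1 / 2) * (G.lap (fun z => f z * g z) x - f x * G.lap g x - g x * G.lap f x)

/-- The iterated carré du champ operator. -/
def Γ₂ (f g : V → ℝ) (x : V) : ℝ :=
  (1 / 2) * (G.lap (G.Γ f g) x - G.Γ f (G.lap g) x - G.Γ g (G.lap f) x)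

/-- The variable curvature dimension condition `CD(ρ, n)`; for `n = ∞` the term `1/n` is `0`. -/
def CD (ρ : V → ℝ) (n : ℝ≥0∞) : Prop :=
  ∀ f : V → ℝ, (∃ C : ℝ, ∀ x, |f x| ≤ C) →
    ∀ x, ρ x * G.Γ f f x + (n⁻¹).toReal * (G.lap f x) ^ 2 ≤ G.Γ₂ f f x

/-- The heat semigroup `P_t = e^{tΔ}` on bounded functions, through the exponential series. When
`Deg_max < ∞`, the Laplacian is a bounded operator on bounded functions and the series converges
absolutely. -/
def heat (t : ℝ) (f : V → ℝ) (x : V) : ℝ :=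
  ∑' n : ℕ, t ^ n / (n.factorial : ℝ) * (G.lap^[n] f) x

/-- `k_T(W) = sup_n ∫_0^T ‖P_t (n ∧ W)‖_∞ dt`. -/
def kato (T : ℝ) (W : V → ℝ) : ℝ≥0∞ :=
  ⨆ n : ℕ, ∫⁻ t in Set.Ioc 0 T, ⨆ x : V, ‖G.heat t (fun y => min (n : ℝ) (W y)) x‖ₑ

/-- `vol U = ∑_{x ∈ U} m(x)`. -/
def vol (U : Set V) : ℝ≥0∞ := ∑' x : U, ENNReal.ofReal (G.m x)

/-- `|∂U| = ∑_{x ∈ U, y ∉ U} w(x,y)`. -/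
def boundary (U : Set V) : ℝ≥0∞ :=
  ∑' (x : U) (y : (Uᶜ : Set V)), ENNReal.ofReal (G.w x y)

/-- The Cheeger constant: the infimum of `|∂U| / vol U` over nonempty `U` of volume at most half
of the total one. The sets of infinite volume, which do not occur in a finite graph, are left out.
The infimum of the empty set (a graph with one vertex) is `∞`. -/
def cheeger : ℝ≥0∞ :=
  ⨅ (U : Set V) (_ : U.Nonempty ∧ G.vol U ≠ ∞ ∧ G.vol U ≤ G.vol Set.univ / 2),
    G.boundary U / G.vol U

/-- `μ` is an eigenvalue of `L = -Δ` in `L²(V, m)`. -/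
def IsEigenvalue (μ : ℝ) : Prop :=
  ∃ f : V → ℝ, f ≠ 0 ∧ Summable (fun x => G.m x * f x ^ 2) ∧ ∀ x, -G.lap f x = μ * f x

/-- The first positive eigenvalue of `L`; it is `∞` if there is none (a graph with one vertex). -/
def lambda1 : ℝ≥0∞ := ⨅ (μ : ℝ) (_ : 0 < μ ∧ G.IsEigenvalue μ), ENNReal.ofReal μ

end

end MWG

/-! This is Ledoux's heat-flow proof of Buser's inequality, with the constant curvature bound
replaced by a Kato condition. Interpolating between the heat semigroup P_t and the semigroup Q_t
generated by Δ - 2ρ gives Γ(P_t f) ≤ Q_t Γ(f) (`Γ_heat_le`). Replace ρ by K - U, where U is a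
truncation of (ρ - K)_-. Then Q_t is e^{-2Kt} times the semigroup of Δ + 2U, which Khasminskii's
argument (`semigroup_one_le`) controls on [0,T] through k_T. The outcome is `gradientBounds`:
flowing for time T contracts sup Γ by e^{-KT}, and Γ(P_t f) ≤ 1/t for |f| ≤ 1 and 0 < t ≤ T.

Iterating the contraction bounds the oscillation of Lipschitz functions. The diameter is therefore
finite and, by local finiteness, so is V (`GradientBounds.finite`). Hence inf q is positive, and the
Poincaré inequality holds by finite-dimensional minimization. Applied to an eigenfunction, the
contraction gives λ ≥ K/2 for every positive eigenvalue.

For the indicator f of U, consider the correlation ∑ m f P_t f. It falls short of vol U by at most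
2√t ∑ m √Γ(f), a multiple of √t |∂U| because Γ(f) is bounded below wherever it is nonzero. Spectral
decay makes the same loss at least (1 - e^{-λt}) vol U / 2. The time t = KT/(2λ) is admissible since
λ ≥ K/2, and comparing the two bounds gives λ ≤ c (|∂U| / vol U)² (`GradientBounds.buser`). -/

section BuserInequality

open scoped BoundedContinuousFunction

set_option maxSynthPendingDepth 4

/-! ### Pointwise calculus of Γ and Γ₂, and truncation of the curvature -/

namespace MWG

variable {V : Type*} (G : MWG V)

theorem mem_nbr {x y : V} : y ∈ G.nbr x ↔ 0 < G.w x y := by simp [nbr]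

theorem q_nonneg (x y : V) : 0 ≤ G.q x y := div_nonneg (G.w_nonneg x y) (G.m_pos x).le

theorem q_pos {x y : V} (h : 0 < G.w x y) : 0 < G.q x y := div_pos h (G.m_pos x)

theorem deg_nonneg (x : V) : 0 ≤ G.deg x := Finset.sum_nonneg fun y _ => G.q_nonneg x y

theorem Γ_eq_sum (f g : V → ℝ) (x : V) :
    G.Γ f g x = 1 / 2 * ∑ y ∈ G.nbr x, G.q x y * ((f y - f x) * (g y - g x)) := by
  simp only [Γ, lap, Finset.mul_sum, ← Finset.sum_sub_distrib]
  exact Finset.sum_congr rfl fun y _ => by ring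

theorem Γ_self_nonneg (f : V → ℝ) (x : V) : 0 ≤ G.Γ f f x := by
  rw [Γ_eq_sum]
  refine mul_nonneg (by norm_num) (Finset.sum_nonneg fun y _ => ?_)
  exact mul_nonneg (G.q_nonneg x y) (mul_self_nonneg _)

theorem q_mul_sq_le_Γ (f : V → ℝ) {x y : V} (h : 0 < G.w x y) :
    G.q x y * (f y - f x) ^ 2 ≤ 2 * G.Γ f f x := by
  have hs := Finset.single_le_sum (f := fun y => G.q x y * ((f y - f x) * (f y - f x)))
    (fun y _ => mul_nonneg (G.q_nonneg x y) (mul_self_nonneg _)) (G.mem_nbr.2 h)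
  rw [Γ_eq_sum]
  nlinarith

theorem m_mul_q (x y : V) : G.m x * G.q x y = G.w x y :=
  mul_div_cancel₀ _ (G.m_pos x).ne'

theorem eq_of_Γ_eq_zero {f : V → ℝ} (h : ∀ x, G.Γ f f x = 0) (x y : V) : f y = f x := by
  have hxy := G.connected x y
  induction hxy with
  | refl => rfl
  | @tail a b _ hab ih =>
    have h1 := G.q_mul_sq_le_Γ f hab
    rw [h a, mul_zero] at h1
    have h2 : (f b - f a) ^ 2 = 0 := le_antisymm
      (nonpos_of_mul_nonpos_right h1 (G.q_pos hab)) (sq_nonneg _)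
    rw [← ih]
    exact sub_eq_zero.1 (pow_eq_zero_iff two_ne_zero |>.1 h2)

theorem Γ_add_mul (f h : V → ℝ) (e : ℝ) (x : V) :
    G.Γ (fun y => f y + e * h y) (fun y => f y + e * h y) x
      = G.Γ f f x + 2 * e * G.Γ f h x + e ^ 2 * G.Γ h h x := by
  simp only [Γ_eq_sum, Finset.mul_sum, ← Finset.sum_add_distrib]
  exact Finset.sum_congr rfl fun y _ => by ring

theorem Γ_const_mul (f : V → ℝ) (c : ℝ) (x : V) :
    G.Γ (fun y => c * f y) (fun y => c * f y) x = c ^ 2 * G.Γ f f x := by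
  simp only [Γ_eq_sum, Finset.mul_sum]
  exact Finset.sum_congr rfl fun y _ => by ring

/-- Where Γ(f) is nonzero some neighbour carries the other value, so Γ(f) ≥ q₀/2 there. This is the
only way the edge weights enter the final constant. -/
theorem sqrt_Γ_le {q₀ : ℝ} (hq₀ : 0 < q₀) (hq : ∀ x y, 0 < G.w x y → q₀ ≤ G.q x y)
    {f : V → ℝ} (hf : ∀ x, f x = 0 ∨ f x = 1) (x : V) :
    √(G.Γ f f x) ≤ √(2 / q₀) * G.Γ f f x := by
  have h0 := G.Γ_self_nonneg f x
  by_cases hΓ : G.Γ f f x = 0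
  · simp [hΓ]
  have hlow : q₀ / 2 ≤ G.Γ f f x := by
    obtain ⟨y, hy, hne⟩ : ∃ y ∈ G.nbr x, f y ≠ f x := by
      by_contra! hc
      refine hΓ ?_
      rw [Γ_eq_sum, Finset.sum_eq_zero, mul_zero]
      intro y hy
      rw [hc y hy]; ring
    have hw := G.mem_nbr.1 hy
    have h1 := G.q_mul_sq_le_Γ f hw
    have h2 : (f y - f x) ^ 2 = 1 := by
      rcases hf x with h | h <;> rcases hf y with h' | h' <;> simp [h, h'] at hne ⊢
    rw [h2] at h1
    linarith [hq x y hw]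
  refine Real.sqrt_le_iff.2 ⟨by positivity, ?_⟩
  rw [mul_pow, Real.sq_sqrt (by positivity), div_mul_eq_mul_div, le_div_iff₀ hq₀]
  nlinarith

/-- Cauchy-Schwarz for the carré du champ. -/
theorem Γ_sq_le (f g : V → ℝ) (x : V) : G.Γ f g x ^ 2 ≤ G.Γ f f x * G.Γ g g x := by
  have h := Finset.sum_mul_sq_le_sq_mul_sq (G.nbr x)
    (fun y => √(G.q x y) * (f y - f x)) (fun y => √(G.q x y) * (g y - g x))
  have e : ∀ a b y, √(G.q x y) * a * (√(G.q x y) * b) = G.q x y * (a * b) := fun a b y => by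
    rw [mul_mul_mul_comm, Real.mul_self_sqrt (G.q_nonneg x y)]
  simp only [sq (√_ * _), e] at h
  simp only [Γ_eq_sum]
  nlinarith

theorem lap_sq_le (f : V → ℝ) (x : V) : G.lap f x ^ 2 ≤ 2 * G.deg x * G.Γ f f x := by
  have h := Finset.sum_mul_sq_le_sq_mul_sq (G.nbr x)
    (fun y => √(G.q x y)) (fun y => √(G.q x y) * (f y - f x))
  have e : ∀ b y, √(G.q x y) * (√(G.q x y) * b) = G.q x y * b := fun b y => by
    rw [← mul_assoc, Real.mul_self_sqrt (G.q_nonneg x y)]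
  have e' : ∀ a b y, √(G.q x y) * a * (√(G.q x y) * b) = G.q x y * (a * b) := fun a b y => by
    rw [mul_mul_mul_comm, Real.mul_self_sqrt (G.q_nonneg x y)]
  simp only [sq (√_ * _), e, e', Real.sq_sqrt (G.q_nonneg x _)] at h
  rw [Γ_eq_sum]
  unfold lap deg
  nlinarith

theorem abs_lap_le {D C : ℝ} (hD : ∀ x, G.deg x ≤ D) {f : V → ℝ} (hf : ∀ x, |f x| ≤ C) (x : V) :
    |G.lap f x| ≤ 2 * D * C := by
  have hC : 0 ≤ C := (abs_nonneg _).trans (hf x)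
  calc |G.lap f x| ≤ ∑ y ∈ G.nbr x, |G.q x y * (f y - f x)| := Finset.abs_sum_le_sum_abs _ _
    _ ≤ ∑ y ∈ G.nbr x, G.q x y * (2 * C) := by
        refine Finset.sum_le_sum fun y _ => ?_
        rw [abs_mul, abs_of_nonneg (G.q_nonneg x y)]
        refine mul_le_mul_of_nonneg_left ?_ (G.q_nonneg x y)
        linarith [abs_sub (f y) (f x), hf y, hf x]
    _ = G.deg x * (2 * C) := by rw [deg, Finset.sum_mul]
    _ ≤ 2 * D * C := by nlinarith [hD x]

theorem Γ₂_self (f : V → ℝ) (x : V) :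
    2 * G.Γ₂ f f x = G.lap (G.Γ f f) x - 2 * G.Γ f (G.lap f) x := by
  unfold Γ₂; ring

/-- A graph with vertex degrees at most `D` has curvature at least `-D`. -/
theorem neg_mul_Γ_le_Γ₂ {D : ℝ} (hD₀ : 0 < D) (hD : ∀ x, G.deg x ≤ D) (f : V → ℝ) (x : V) :
    -D * G.Γ f f x ≤ G.Γ₂ f f x := by
  have h2 := G.Γ₂_self f x
  have hΓ := G.Γ_eq_sum f f x
  have hL : G.lap (G.Γ f f) x = ∑ y ∈ G.nbr x, G.q x y * G.Γ f f y - G.deg x * G.Γ f f x := by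
    simp only [lap, deg, mul_sub, Finset.sum_sub_distrib, Finset.sum_mul]
  have hM : 2 * G.Γ f (G.lap f) x
      = ∑ y ∈ G.nbr x, G.q x y * ((f y - f x) * G.lap f y) - G.lap f x ^ 2 := by
    have hl : G.lap f x ^ 2 = ∑ y ∈ G.nbr x, G.q x y * (f y - f x) * G.lap f x :=
      (sq _).trans (Finset.sum_mul ..)
    rw [Γ_eq_sum, hl, ← Finset.sum_sub_distrib, ← mul_assoc, Finset.mul_sum]
    exact Finset.sum_congr rfl fun y _ => by ring
  have hS : ∑ y ∈ G.nbr x, G.q x y * ((f y - f x) * G.lap f y)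
      ≤ D * G.Γ f f x + ∑ y ∈ G.nbr x, G.q x y * G.Γ f f y := by
    rw [hΓ, ← mul_assoc, Finset.mul_sum, ← Finset.sum_add_distrib]
    refine Finset.sum_le_sum fun y _ => ?_
    have hy := G.lap_sq_le f y
    have hy' : G.lap f y ^ 2 ≤ 2 * D * G.Γ f f y := hy.trans (by
      nlinarith [G.Γ_self_nonneg f y, hD y])
    -- Young's inequality with weight D: the part (Δf(y))²/(2D) is at most Γ(f)(y), which cancels
    -- against the same term in ΔΓ(f)(x).
    have : (f y - f x) * G.lap f y ≤ D / 2 * (f y - f x) ^ 2 + G.Γ f f y := by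
      have h0 : 0 ≤ (D * (f y - f x) - G.lap f y) ^ 2 := sq_nonneg _
      have : D * ((f y - f x) * G.lap f y) ≤ D * (D / 2 * (f y - f x) ^ 2 + G.Γ f f y) := by
        nlinarith
      exact le_of_mul_le_mul_left this hD₀
    have := mul_le_mul_of_nonneg_left this (G.q_nonneg x y)
    nlinarith
  nlinarith [G.Γ_self_nonneg f x, hD x, sq_nonneg (G.lap f x)]

/-- The curvature bound may be cut off from below at minus the maximal degree. -/
theorem CD.truncate {ρ : V → ℝ} {D K : ℝ} (h : G.CD ρ ∞) (hD₀ : 0 < D) (hD : ∀ x, G.deg x ≤ D)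
    {n : ℝ} (hn : K + D ≤ n) :
    G.CD (fun x => K - min n (-min 0 (ρ x - K))) ∞ := by
  intro f hf x
  have h1 := h f hf x
  have h2 := G.neg_mul_Γ_le_Γ₂ hD₀ hD f x
  have h3 := G.Γ_self_nonneg f x
  simp only [ENNReal.inv_top, ENNReal.toReal_zero, zero_mul, add_zero] at h1 ⊢
  -- Either the cut-off is active and K - n ≤ -D, the curvature every such graph has, or the left
  -- side is min(K, ρ x).
  have : K - min n (-min 0 (ρ x - K)) ≤ max (ρ x) (-D) := by
    rcases le_total n (-min 0 (ρ x - K)) with hc | hc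
    · rw [min_eq_left hc]; exact le_max_of_le_right (by linarith)
    · rw [min_eq_right hc]; exact le_max_of_le_left (by linarith [min_le_right 0 (ρ x - K)])
  rcases le_max_iff.1 this with hc | hc <;> nlinarith

theorem exists_deg_le (h : G.degMax < ∞) : ∃ D : ℝ, 0 < D ∧ ∀ x, G.deg x ≤ D := by
  -- The summand 1 keeps `D` positive on a one-vertex graph.
  refine ⟨G.degMax.toReal + 1, by positivity, fun x => ?_⟩
  have : ENNReal.ofReal (G.deg x) ≤ G.degMax := le_iSup (fun x => ENNReal.ofReal (G.deg x)) x
  have := (ENNReal.ofReal_le_iff_le_toReal h.ne).1 this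
  linarith

end MWG

/-! ### Exponentials of bounded operators: positivity and derivatives -/

section PositiveSemigroup

variable {V : Type*} [TopologicalSpace V]

/-- The exponential series of an operator on bounded functions, evaluated at a point. -/
theorem hasSum_exp_apply_apply (A : (V →ᵇ ℝ) →L[ℝ] (V →ᵇ ℝ)) (f : V →ᵇ ℝ) (x : V) :
    HasSum (fun n : ℕ => ((n.factorial : ℝ)⁻¹) * (A ^ n) f x) (NormedSpace.exp A f x) := by
  have h := NormedSpace.exp_series_hasSum_exp' (𝕂 := ℝ) A
  exact h.mapL ((BoundedContinuousFunction.evalCLM ℝ x).comp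
    (ContinuousLinearMap.apply ℝ (V →ᵇ ℝ) f))

theorem exp_nonneg_of_nonneg {A : (V →ᵇ ℝ) →L[ℝ] (V →ᵇ ℝ)} (hA : ∀ f, 0 ≤ f → 0 ≤ A f)
    {f : V →ᵇ ℝ} (hf : 0 ≤ f) : 0 ≤ NormedSpace.exp A f := by
  have hp : ∀ n : ℕ, 0 ≤ (A ^ n) f := by
    intro n
    induction n with
    | zero => simpa using hf
    | succ n ih => rw [pow_succ']; exact hA _ ih
  intro x
  exact (hasSum_exp_apply_apply A f x).nonneg fun n => mul_nonneg (by positivity) (hp n x)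

theorem exp_add_smul_one (A : (V →ᵇ ℝ) →L[ℝ] (V →ᵇ ℝ)) (c : ℝ) :
    NormedSpace.exp (A + c • (1 : (V →ᵇ ℝ) →L[ℝ] (V →ᵇ ℝ))) = Real.exp c • NormedSpace.exp A := by
  let _ : NormedAlgebra ℚ ((V →ᵇ ℝ) →L[ℝ] (V →ᵇ ℝ)) := NormedAlgebra.restrictScalars ℚ ℝ _
  rw [NormedSpace.exp_add_of_commute ((Commute.one_right A).smul_right c),
    ← Algebra.algebraMap_eq_smul_one,
    ← NormedSpace.algebraMap_exp_comm, Algebra.algebraMap_eq_smul_one, mul_smul_comm, mul_one,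
    Real.exp_eq_exp_ℝ]

/-- Adding a multiple of the identity makes the generator positivity preserving and only rescales
the exponential by a positive factor. -/
theorem exp_smul_nonneg {A : (V →ᵇ ℝ) →L[ℝ] (V →ᵇ ℝ)} {c : ℝ} (hA : ∀ f, 0 ≤ f → 0 ≤ A f + c • f)
    {t : ℝ} (ht : 0 ≤ t) {f : V →ᵇ ℝ} (hf : 0 ≤ f) : 0 ≤ NormedSpace.exp (t • A) f := by
  have h1 : 0 ≤ NormedSpace.exp (t • A + (t * c) • (1 : (V →ᵇ ℝ) →L[ℝ] (V →ᵇ ℝ))) f := by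
    refine exp_nonneg_of_nonneg (fun g hg => ?_) hf
    intro x
    have h2 : 0 ≤ A g x + c * g x := hA g hg x
    change 0 ≤ t * A g x + (t * c) * g x
    nlinarith [mul_nonneg ht h2]
  rw [exp_add_smul_one] at h1
  intro x
  have h2 : 0 ≤ Real.exp (t * c) * NormedSpace.exp (t • A) f x := h1 x
  exact nonneg_of_mul_nonneg_right h2 (Real.exp_pos _)

end PositiveSemigroup

/-- The tool behind the interpolation arguments. The derivative is asked for only inside the
interval so that √s may occur in `F`. -/
theorem le_of_hasDerivAt_nonneg {F F' : ℝ → ℝ} {t : ℝ} (ht : 0 ≤ t)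
    (hc : ContinuousOn F (Set.Icc 0 t)) (hF : ∀ s ∈ Set.Ioo 0 t, HasDerivAt F (F' s) s)
    (hF' : ∀ s ∈ Set.Ioo 0 t, 0 ≤ F' s) : F 0 ≤ F t := by
  rw [← interior_Icc] at hF hF'
  have hm : MonotoneOn F (Set.Icc 0 t) :=
    monotoneOn_of_deriv_nonneg (convex_Icc 0 t) hc
      (fun s hs => (hF s hs).differentiableAt.differentiableWithinAt)
      fun s hs => (hF s hs).deriv ▸ hF' s hs
  exact hm ⟨le_rfl, ht⟩ ⟨ht, le_rfl⟩ ht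

theorem le_of_forall_hasDerivAt_nonneg {F F' : ℝ → ℝ} {t : ℝ} (ht : 0 ≤ t)
    (hF : ∀ s, HasDerivAt F (F' s) s) (hF' : ∀ s ∈ Set.Ioo 0 t, 0 ≤ F' s) : F 0 ≤ F t :=
  le_of_hasDerivAt_nonneg ht (fun s _ => (hF s).continuousAt.continuousWithinAt)
    (fun s _ => hF s) hF'

section ExpDeriv

variable {E : Type*} [NormedAddCommGroup E] [NormedSpace ℝ E] [CompleteSpace E]

theorem hasDerivAt_exp_smul_apply (A : E →L[ℝ] E) {g : ℝ → E} {g' : E} {s : ℝ}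
    (hg : HasDerivAt g g' s) :
    HasDerivAt (fun s : ℝ => NormedSpace.exp (s • A) (g s))
      (NormedSpace.exp (s • A) (A (g s) + g')) s := by
  have h := (hasDerivAt_exp_smul_const (𝕂 := ℝ) A s).clm_apply hg
  rw [map_add]
  exact h

theorem hasDerivAt_exp_const_smul_apply (A : E →L[ℝ] E) (f : E) (s : ℝ) :
    HasDerivAt (fun s : ℝ => NormedSpace.exp (s • A) f) (A (NormedSpace.exp (s • A) f)) s := by
  have h := (hasDerivAt_exp_smul_const' (𝕂 := ℝ) A s).clm_apply (hasDerivAt_const s f)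
  rw [map_zero, add_zero] at h
  exact h

theorem hasDerivAt_exp_sub_smul_apply (A : E →L[ℝ] E) (f : E) (t s : ℝ) :
    HasDerivAt (fun s : ℝ => NormedSpace.exp ((t - s) • A) f)
      (-A (NormedSpace.exp ((t - s) • A) f)) s := by
  have h := (hasDerivAt_exp_const_smul_apply A f (t - s)).scomp s
    ((hasDerivAt_id s).const_sub t)
  rw [neg_one_smul] at h
  exact h

end ExpDeriv

/-! ### Semigroups with potential and gradient estimates -/

namespace MWG

variable {V : Type*} (G : MWG V) [TopologicalSpace V] [DiscreteTopology V]

/-- The Laplacian as a bounded operator on bounded functions. -/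
noncomputable def lapCLM {D : ℝ} (hD : ∀ x, G.deg x ≤ D) : (V →ᵇ ℝ) →L[ℝ] (V →ᵇ ℝ) :=
  LinearMap.mkContinuous
    { toFun := fun f => BoundedContinuousFunction.ofNormedAddCommGroupDiscrete (G.lap f)
        (2 * D * ‖f‖) (fun x => G.abs_lap_le hD (fun y => f.norm_coe_le_norm y) x)
      map_add' := fun f g => by
        ext x
        simp only [BoundedContinuousFunction.coe_ofNormedAddCommGroupDiscrete,
          BoundedContinuousFunction.coe_add, Pi.add_apply, lap, ← Finset.sum_add_distrib]
        exact Finset.sum_congr rfl fun y _ => by ring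
      map_smul' := fun c f => by
        ext x
        simp only [BoundedContinuousFunction.coe_ofNormedAddCommGroupDiscrete,
          BoundedContinuousFunction.coe_smul, smul_eq_mul, lap, Finset.mul_sum, RingHom.id_apply]
        exact Finset.sum_congr rfl fun y _ => by ring }
    (2 * max D 0) (fun f => by
      refine (BoundedContinuousFunction.norm_le (by positivity)).2 fun x => ?_
      refine (G.abs_lap_le hD (fun y => f.norm_coe_le_norm y) x).trans ?_
      gcongr
      exact le_max_left D 0)

variable {D : ℝ} (hD : ∀ x, G.deg x ≤ D)

/-- The semigroup generated by the Laplacian plus the potential `v`. -/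
noncomputable def semigroup (v : V →ᵇ ℝ) (t : ℝ) : (V →ᵇ ℝ) →L[ℝ] (V →ᵇ ℝ) :=
  NormedSpace.exp (t • (G.lapCLM hD + ContinuousLinearMap.mul ℝ (V →ᵇ ℝ) v))

theorem semigroup_zero (v : V →ᵇ ℝ) : G.semigroup hD v 0 = 1 := by simp [semigroup]

theorem heat_eq_semigroup (t : ℝ) (f : V →ᵇ ℝ) (x : V) :
    G.heat t f x = G.semigroup hD 0 t f x := by
  have hp : ∀ n : ℕ, (⇑((G.lapCLM hD ^ n) f) : V → ℝ) = G.lap^[n] f := by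
    intro n
    induction n with
    | zero => rfl
    | succ n ih => rw [pow_succ', Function.iterate_succ_apply', ← ih]; rfl
  have h := hasSum_exp_apply_apply (t • G.lapCLM hD) f x
  rw [semigroup, map_zero, add_zero, ← h.tsum_eq, heat]
  refine tsum_congr fun n => ?_
  rw [smul_pow]
  change _ = ((n.factorial : ℝ)⁻¹) * (t ^ n * (G.lapCLM hD ^ n) f x)
  rw [hp]
  ring

theorem heat_eigenfunction {μ : ℝ} {f : V →ᵇ ℝ} (hf : ∀ x, -G.lap f x = μ * f x) (t : ℝ) (x : V) :
    G.semigroup hD 0 t f x = Real.exp (-μ * t) * f x := by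
  have hit : ∀ n : ℕ, G.lap^[n] f = fun x => (-μ) ^ n * f x := by
    intro n
    induction n with
    | zero => simp
    | succ n ih =>
      ext x
      have h1 : G.lap (fun x => (-μ) ^ n * f x) x = (-μ) ^ n * G.lap f x := by
        simp only [lap, Finset.mul_sum]
        exact Finset.sum_congr rfl fun y _ => by ring
      rw [Function.iterate_succ_apply', ih, h1, ← neg_neg (G.lap f x), hf]
      ring
  rw [← heat_eq_semigroup, heat, Real.exp_eq_exp_ℝ, NormedSpace.exp_eq_tsum_div, ← tsum_mul_right]
  refine tsum_congr fun n => ?_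
  rw [hit, mul_pow]
  ring

theorem semigroup_nonneg (v : V →ᵇ ℝ) {t : ℝ} (ht : 0 ≤ t) {f : V →ᵇ ℝ} (hf : 0 ≤ f) :
    0 ≤ G.semigroup hD v t f := by
  -- The only negative contributions to (Δ + v)g for g ≥ 0 are diagonal, and this shift absorbs
  -- them.
  refine exp_smul_nonneg (c := D + ‖v‖) (fun g hg => ?_) ht hf
  intro x
  have h1 : -(G.deg x * g x) ≤ G.lap g x := by
    rw [deg, Finset.sum_mul, ← Finset.sum_neg_distrib]
    refine Finset.sum_le_sum fun y _ => ?_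
    have h : 0 ≤ G.q x y * g y := mul_nonneg (G.q_nonneg x y) (hg y)
    linarith
  have h2 : -‖v‖ ≤ v x := (abs_le.1 (v.norm_coe_le_norm x)).1
  have h3 : 0 ≤ g x := hg x
  have h4 := hD x
  change 0 ≤ G.lap g x + v x * g x + (D + ‖v‖) * g x
  nlinarith

theorem semigroup_mono (v : V →ᵇ ℝ) {t : ℝ} (ht : 0 ≤ t) {f g : V →ᵇ ℝ} (hfg : f ≤ g) :
    G.semigroup hD v t f ≤ G.semigroup hD v t g := by
  have := G.semigroup_nonneg hD v ht (sub_nonneg.2 hfg)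
  rwa [map_sub, sub_nonneg] at this

theorem semigroup_add_const (v : V →ᵇ ℝ) (c t : ℝ) :
    G.semigroup hD (v + BoundedContinuousFunction.const V c) t
      = Real.exp (t * c) • G.semigroup hD v t := by
  rw [semigroup, semigroup, ← exp_add_smul_one]
  congr 1
  ext f x
  simp
  ring

theorem semigroup_one (t : ℝ) : G.semigroup hD 0 t 1 = 1 := by
  ext x
  rw [← heat_eq_semigroup, heat, tsum_eq_single 0]
  · simp
  · intro n hn
    obtain ⟨k, rfl⟩ := Nat.exists_eq_succ_of_ne_zero hn
    have h1 : G.lap (⇑(1 : V →ᵇ ℝ)) = fun _ => 0 := by ext; simp [lap]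
    have h0 : ∀ k : ℕ, G.lap^[k] (fun _ : V => (0 : ℝ)) = fun _ => 0 := by
      intro k
      induction k with
      | zero => rfl
      | succ k ih => rw [Function.iterate_succ_apply', ih]; ext; simp [lap]
    rw [Function.iterate_succ_apply, h1, h0, mul_zero]

theorem semigroup_apply_le {v : V →ᵇ ℝ} {t C M : ℝ} (ht : 0 ≤ t) (hC : 0 ≤ C)
    (hM : ∀ x, G.semigroup hD v t 1 x ≤ M) {f : V →ᵇ ℝ} (hf : ∀ x, f x ≤ C) (x : V) :
    G.semigroup hD v t f x ≤ C * M := by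
  have h : f ≤ C • (1 : V →ᵇ ℝ) := fun y => by simpa using hf y
  refine (G.semigroup_mono hD v ht h x).trans ?_
  rw [map_smul]
  exact mul_le_mul_of_nonneg_left (hM x) hC

theorem hasDerivAt_semigroup_apply (v : V →ᵇ ℝ) {g : ℝ → V →ᵇ ℝ} {g' : V →ᵇ ℝ} {s : ℝ}
    (hg : HasDerivAt g g' s) (x : V) :
    HasDerivAt (fun s : ℝ => G.semigroup hD v s (g s) x)
      (G.semigroup hD v s (G.lapCLM hD (g s) + v * g s + g') x) s := by
  have h := (BoundedContinuousFunction.evalCLM ℝ x).hasFDerivAt.comp_hasDerivAt s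
    (hasDerivAt_exp_smul_apply (G.lapCLM hD + ContinuousLinearMap.mul ℝ (V →ᵇ ℝ) v) hg)
  exact h

theorem hasDerivAt_semigroup_sub (v f : V →ᵇ ℝ) (t s : ℝ) :
    HasDerivAt (fun s : ℝ => G.semigroup hD v (t - s) f)
      (-(G.lapCLM hD (G.semigroup hD v (t - s) f) + v * G.semigroup hD v (t - s) f)) s :=
  hasDerivAt_exp_sub_smul_apply (G.lapCLM hD + ContinuousLinearMap.mul ℝ (V →ᵇ ℝ) v) f t s

theorem hasDerivAt_heat (f : V →ᵇ ℝ) (t : ℝ) (x : V) :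
    HasDerivAt (fun t : ℝ => G.semigroup hD 0 t f x) (G.lap (G.semigroup hD 0 t f) x) t := by
  have h := (BoundedContinuousFunction.evalCLM ℝ x).hasFDerivAt.comp_hasDerivAt t
    (hasDerivAt_exp_const_smul_apply (G.lapCLM hD + ContinuousLinearMap.mul ℝ (V →ᵇ ℝ) 0) f t)
  rw [map_zero, add_zero] at h
  unfold semigroup
  rw [map_zero, add_zero]
  exact h

theorem heat_add (s t : ℝ) (f : V →ᵇ ℝ) :
    G.semigroup hD 0 (s + t) f = G.semigroup hD 0 s (G.semigroup hD 0 t f) := by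
  let _ : NormedAlgebra ℚ ((V →ᵇ ℝ) →L[ℝ] (V →ᵇ ℝ)) := NormedAlgebra.restrictScalars ℚ ℝ _
  rw [semigroup, add_smul, NormedSpace.exp_add_of_commute
    (((Commute.refl _).smul_left s).smul_right t)]
  rfl

/-- The carré du champ of bounded functions as a bounded function. -/
noncomputable def ΓB (f g : V →ᵇ ℝ) : V →ᵇ ℝ :=
  (1 / 2 : ℝ) • (G.lapCLM hD (f * g) - f * G.lapCLM hD g - g * G.lapCLM hD f)

theorem ΓB_apply (f g : V →ᵇ ℝ) (x : V) : G.ΓB hD f g x = G.Γ f g x := rfl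

theorem hasDerivAt_ΓB_heat_sub (f : V →ᵇ ℝ) (t s : ℝ) :
    HasDerivAt (fun s : ℝ => G.ΓB hD (G.semigroup hD 0 (t - s) f) (G.semigroup hD 0 (t - s) f))
      (-(2 : ℝ) • G.ΓB hD (G.semigroup hD 0 (t - s) f)
        (G.lapCLM hD (G.semigroup hD 0 (t - s) f))) s := by
  have hg := G.hasDerivAt_semigroup_sub hD 0 f t s
  rw [zero_mul, add_zero] at hg
  have hΔ := (G.lapCLM hD).hasFDerivAt.comp_hasDerivAt s hg
  have h := (((G.lapCLM hD).hasFDerivAt.comp_hasDerivAt s (hg.mul hg)).sub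
    (hg.mul hΔ) |>.sub (hg.mul hΔ)).const_smul (1 / 2 : ℝ)
  refine h.congr_deriv ?_
  set g := G.semigroup hD 0 (t - s) f
  simp only [ΓB, Function.comp_apply, map_neg, map_add, neg_mul, mul_neg,
    mul_comm (G.lapCLM hD g) g]
  module

/-- The gradient estimate for the heat semigroup under a variable curvature bound. -/
theorem Γ_heat_le {ρ : V →ᵇ ℝ} (hρ : G.CD ρ ∞) {t : ℝ} (ht : 0 ≤ t) (f : V →ᵇ ℝ) (x : V) :
    G.Γ (G.semigroup hD 0 t f) (G.semigroup hD 0 t f) x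
      ≤ G.semigroup hD (-(2 : ℝ) • ρ) t (G.ΓB hD f f) x := by
  -- The interpolation is s ↦ Q_s Γ(P_{t-s} f). With g = P_{t-s} f its derivative is Q_s(ΔΓ(g) -
  -- 2ρΓ(g) - 2Γ(g, Δg)) = 2 Q_s(Γ₂(g) - ρΓ(g)).
  have h := le_of_forall_hasDerivAt_nonneg ht (fun s =>
    G.hasDerivAt_semigroup_apply hD (-(2 : ℝ) • ρ) (G.hasDerivAt_ΓB_heat_sub hD f t s) x)
    (fun s hs => by
      refine G.semigroup_nonneg hD _ hs.1.le ?_ x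
      intro y
      set g := G.semigroup hD 0 (t - s) f
      have h1 := hρ g ⟨‖g‖, fun z => g.norm_coe_le_norm z⟩ y
      have h2 := G.Γ₂_self g y
      simp only [ENNReal.inv_top, ENNReal.toReal_zero, zero_mul, add_zero] at h1
      change 0 ≤ G.lap (G.Γ g g) y + (-2 * ρ y) * G.Γ g g y + -2 * G.Γ g (G.lap g) y
      linarith)
  simpa [semigroup_zero, ΓB_apply] using h

/-- Khasminskii's bound for the semigroup perturbed by a small nonnegative potential. -/
theorem semigroup_one_le {U : V →ᵇ ℝ} (hU : 0 ≤ U) {T k : ℝ} (hT : 0 ≤ T) (hk : 2 * k < 1)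
    (hUk : ∀ x, ∀ t ∈ Set.Icc 0 T, ∫ r in (0 : ℝ)..t, G.semigroup hD 0 r U x ≤ k)
    {t : ℝ} (ht : t ∈ Set.Icc 0 T) (x : V) :
    G.semigroup hD ((2 : ℝ) • U) t 1 x ≤ 1 / (1 - 2 * k) := by
  set Q := G.semigroup hD ((2 : ℝ) • U) with hQ
  have hcont : ∀ x, Continuous fun r => G.semigroup hD 0 r U x := fun x =>
    continuous_iff_continuousAt.2 fun r => (G.hasDerivAt_heat hD U r x).continuousAt
  -- Duhamel's formula as an inequality: P_s Q_{t-s} 1 + 2S ∫_0^s P_r U increases in s, from Q_t 1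
  -- to 1 + 2S ∫_0^t P_r U.
  have step : ∀ S : ℝ, (∀ r ∈ Set.Icc 0 T, ∀ y, Q r 1 y ≤ S) →
      ∀ t ∈ Set.Icc 0 T, ∀ x, Q t 1 x ≤ 1 + 2 * S * k := by
    intro S hS t ht x
    have hS0 : 0 ≤ S := by
      have := hS 0 ⟨le_rfl, hT⟩ x
      rw [hQ, semigroup_zero] at this
      exact zero_le_one.trans this
    have h := le_of_forall_hasDerivAt_nonneg ht.1 (fun s =>
      (G.hasDerivAt_semigroup_apply hD 0 (G.hasDerivAt_semigroup_sub hD ((2 : ℝ) • U) 1 t s) x).add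
      (((hcont x).integral_hasStrictDerivAt 0 s).hasDerivAt.const_mul (2 * S))) (fun s hs => by
        have hle : -(2 * S) • U ≤ G.lapCLM hD (Q (t - s) 1) + 0 * Q (t - s) 1
            + -(G.lapCLM hD (Q (t - s) 1) + (2 : ℝ) • U * Q (t - s) 1) := by
          intro y
          have h1 := hS (t - s) ⟨by linarith [hs.2], by linarith [hs.1, ht.2]⟩ y
          have h2 : 0 ≤ U y := hU y
          change -(2 * S) * U y ≤ G.lap (Q (t - s) 1) y + 0 * Q (t - s) 1 y
            + -(G.lap (Q (t - s) 1) y + (2 * U y) * Q (t - s) 1 y)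
          nlinarith
        have := G.semigroup_mono hD 0 hs.1.le hle
        rw [map_smul] at this
        have : -(2 * S) * G.semigroup hD 0 s U x ≤ G.semigroup hD 0 s _ x := this x
        linarith)
    simp only [Pi.add_apply, semigroup_zero, sub_zero, sub_self, intervalIntegral.integral_same,
      mul_zero, add_zero, one_apply_eq_self, semigroup_one] at h
    refine h.trans ?_
    have := mul_le_mul_of_nonneg_left (hUk x t ht) (mul_nonneg zero_le_two hS0)
    simpa using this
  -- The supremum S of Q_r 1 satisfies S ≤ 1 + 2Sk. Its finiteness, needed to solve for S, comes
  -- from norm continuity on [0,T].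
  set A : Set ℝ := {a | ∃ r ∈ Set.Icc 0 T, ∃ y, a = Q r 1 y} with hA
  have hbdd : BddAbove A := by
    have hc : Continuous Q := by
      rw [hQ]
      exact continuous_iff_continuousAt.2 fun r =>
        (hasDerivAt_exp_smul_const (𝕂 := ℝ) _ r).continuousAt
    obtain ⟨C, hC⟩ := (isCompact_Icc (a := (0 : ℝ)) (b := T)).exists_bound_of_continuousOn
      (hc.clm_apply continuous_const (g := fun _ => (1 : V →ᵇ ℝ))).continuousOn
    refine ⟨C, ?_⟩
    rintro a ⟨r, hr, y, rfl⟩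
    exact (le_abs_self _).trans (((Q r 1).norm_coe_le_norm y).trans (hC r hr))
  have hle : ∀ r ∈ Set.Icc 0 T, ∀ y, Q r 1 y ≤ sSup A := fun r hr y =>
    le_csSup hbdd ⟨r, hr, y, rfl⟩
  have hS : sSup A ≤ 1 + 2 * sSup A * k :=
    csSup_le ⟨_, t, ht, x, rfl⟩ (by rintro a ⟨r, hr, y, rfl⟩; exact step _ hle r hr y)
  refine (hle t ht x).trans ?_
  rw [le_div_iff₀ (by linarith)]
  linarith

/-- Exponentially weighted gradient bound. -/
theorem Γ_heat_le_exp_mul {K C M t : ℝ} {U : V →ᵇ ℝ}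
    (hCD : G.CD (fun x => K - U x) ∞) (ht : 0 ≤ t)
    (hM : ∀ x, G.semigroup hD ((2 : ℝ) • U) t 1 x ≤ M) {f : V →ᵇ ℝ}
    (hf : ∀ x, G.Γ f f x ≤ C) (x : V) :
    G.Γ (G.semigroup hD 0 t f) (G.semigroup hD 0 t f) x ≤ Real.exp (-2 * K * t) * (C * M) := by
  have hC : 0 ≤ C := (G.Γ_self_nonneg f x).trans (hf x)
  have h := G.Γ_heat_le hD (ρ := BoundedContinuousFunction.const V K - U) hCD ht f x
  have e : -(2 : ℝ) • (BoundedContinuousFunction.const V K - U)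
      = (2 : ℝ) • U + BoundedContinuousFunction.const V (-2 * K) := by
    ext y; simp; ring
  rw [e, semigroup_add_const] at h
  refine h.trans ?_
  change Real.exp (t * (-2 * K)) * G.semigroup hD ((2 : ℝ) • U) t (G.ΓB hD f f) x ≤ _
  rw [show t * (-2 * K) = -2 * K * t by ring]
  exact mul_le_mul_of_nonneg_left (G.semigroup_apply_le hD ht hC hM hf x) (Real.exp_pos _).le

/-- The reverse Poincaré inequality. -/
theorem mul_Γ_heat_le {K M t : ℝ} (hK : 0 ≤ K) {U : V →ᵇ ℝ} (hU : 0 ≤ U)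
    (hCD : G.CD (fun x => K - U x) ∞) (ht : 0 ≤ t)
    (hM : ∀ x, G.semigroup hD ((2 : ℝ) • U) t 1 x ≤ M) {f : V →ᵇ ℝ}
    (hf : ∀ x, |f x| ≤ 1) (x : V) :
    2 * t * G.Γ (G.semigroup hD 0 t f) (G.semigroup hD 0 t f) x ≤ M := by
  -- The gain from K is discarded, so the same semigroup, that of Δ + 2U, serves for the gradient
  -- estimate and for the interpolation.
  have hCD' : G.CD (⇑(-U)) ∞ := by
    intro g hg y
    refine le_trans ?_ (hCD g hg y)
    have := G.Γ_self_nonneg g y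
    simp only [BoundedContinuousFunction.coe_neg, Pi.neg_apply]
    nlinarith
  set γ := G.Γ (G.semigroup hD 0 t f) (G.semigroup hD 0 t f) x with hγ
  have hder : ∀ s, HasDerivAt
      (fun s => G.semigroup hD 0 (t - s) f * G.semigroup hD 0 (t - s) f)
      (-(2 : ℝ) • (G.semigroup hD 0 (t - s) f * G.lapCLM hD (G.semigroup hD 0 (t - s) f))) s := by
    intro s
    have hg := G.hasDerivAt_semigroup_sub hD 0 f t s
    rw [zero_mul, add_zero] at hg
    refine (hg.mul hg).congr_deriv ?_
    simp only [neg_mul, mul_neg,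
      mul_comm (G.lapCLM hD (G.semigroup hD 0 (t - s) f)) (G.semigroup hD 0 (t - s) f)]
    module
  -- With g = P_{t-s} f, the derivative of Q_s(g²) is Q_s(2Γ(g) + 2Ug²), at least 2 Q_s Γ(g) ≥
  -- 2Γ(P_s g) = 2γ.
  have h := le_of_forall_hasDerivAt_nonneg ht (fun s =>
    (G.hasDerivAt_semigroup_apply hD ((2 : ℝ) • U) (hder s) x).sub
      ((hasDerivAt_id s).const_mul (2 * γ))) (fun s hs => by
      set g := G.semigroup hD 0 (t - s) f with hg
      have h1 : γ ≤ G.semigroup hD ((2 : ℝ) • U) s (G.ΓB hD g g) x := by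
        have := G.Γ_heat_le hD hCD' hs.1.le g x
        rw [hg, ← heat_add, add_sub_cancel] at this
        simpa [hγ, hg] using this
      have hle : (2 : ℝ) • G.ΓB hD g g ≤ G.lapCLM hD (g * g) + (2 : ℝ) • U * (g * g)
          + -(2 : ℝ) • (g * G.lapCLM hD g) := by
        intro y
        have h2 : 0 ≤ U y := hU y
        change 2 * (1 / 2 * (G.lap (fun z => g z * g z) y - g y * G.lap g y - g y * G.lap g y))
          ≤ G.lap (fun z => g z * g z) y + (2 * U y) * (g y * g y) + -2 * (g y * G.lap g y)
        nlinarith [mul_nonneg h2 (mul_self_nonneg (g y))]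
      have h3 := G.semigroup_mono hD ((2 : ℝ) • U) hs.1.le hle
      rw [map_smul] at h3
      have h3 : 2 * G.semigroup hD ((2 : ℝ) • U) s (G.ΓB hD g g) x
        ≤ G.semigroup hD ((2 : ℝ) • U) s _ x := h3 x
      linarith)
  have h4 := G.semigroup_apply_le hD ht zero_le_one hM (f := f * f) (fun y => by
    have := abs_le.1 (hf y)
    change f y * f y ≤ 1
    nlinarith) x
  simp only [Pi.sub_apply, semigroup_zero, sub_zero, sub_self, id_eq, mul_zero,
    one_apply_eq_self] at h
  have h5 : 0 ≤ (G.semigroup hD 0 t f * G.semigroup hD 0 t f) x := mul_self_nonneg _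
  linarith

end MWG

/-! ### Gradient bounds from the Kato condition, and bounded oscillation -/

namespace MWG

section Bounds

variable {V : Type*} (G : MWG V) [TopologicalSpace V] [DiscreteTopology V]
variable {D : ℝ} (hD : ∀ x, G.deg x ≤ D)

theorem integral_heat_le_kato {T : ℝ} {n : ℕ} {W : V → ℝ} {U : V →ᵇ ℝ}
    (hUW : ∀ x, U x = min (n : ℝ) (W x)) (hU : 0 ≤ U) (hk : G.kato T W ≠ ∞) (x : V)
    {t : ℝ} (ht : t ∈ Set.Icc 0 T) :
    ∫ r in (0 : ℝ)..t, G.semigroup hD 0 r U x ≤ (G.kato T W).toReal := by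
  have hcont : Continuous fun r => G.semigroup hD 0 r U x :=
    continuous_iff_continuousAt.2 fun r => (G.hasDerivAt_heat hD U r x).continuousAt
  rw [← ENNReal.ofReal_le_iff_le_toReal hk, intervalIntegral.integral_of_le ht.1,
    MeasureTheory.ofReal_integral_eq_lintegral_ofReal]
  · refine le_trans ?_ (le_iSup _ n)
    refine (MeasureTheory.lintegral_mono_set (Set.Ioc_subset_Ioc_right ht.2)).trans ?_
    refine MeasureTheory.lintegral_mono fun r => ?_
    refine le_trans ?_ (le_iSup _ x)
    have e : (fun y => min (n : ℝ) (W y)) = U := funext fun y => (hUW y).symm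
    rw [e, heat_eq_semigroup G hD]
    exact Real.ofReal_le_enorm _
  · exact (hcont.integrableOn_Icc).mono_set Set.Ioc_subset_Icc_self
  · refine (MeasureTheory.ae_restrict_iff' measurableSet_Ioc).2 (Filter.Eventually.of_forall ?_)
    intro r hr
    exact G.semigroup_nonneg hD 0 hr.1.le hU x

/-- The gradient bounds for the heat semigroup on which the geometric results rest. -/
structure GradientBounds (K T : ℝ) : Prop where
  contraction : ∀ (f : V →ᵇ ℝ) (C : ℝ), (∀ x, G.Γ f f x ≤ C) →
    ∀ x, G.Γ (G.semigroup hD 0 T f) (G.semigroup hD 0 T f) x ≤ Real.exp (-K * T / 2) ^ 2 * C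
  bounded : ∀ (f : V →ᵇ ℝ) (C : ℝ), (∀ x, G.Γ f f x ≤ C) → ∀ t ∈ Set.Icc 0 T,
    ∀ x, G.Γ (G.semigroup hD 0 t f) (G.semigroup hD 0 t f) x ≤ 2 * C
  regularizing : ∀ f : V →ᵇ ℝ, (∀ x, |f x| ≤ 1) → ∀ t ∈ Set.Icc 0 T,
    ∀ x, t * G.Γ (G.semigroup hD 0 t f) (G.semigroup hD 0 t f) x ≤ 1

/-- With s = e^{-KT/2}, the Kato hypothesis gives 1 - 2k > (1 + s)/2, so Khasminskii's bound is at
most 2/(1 + s) ≤ 2. At time T the factor e^{-2KT} = s⁴ absorbs it and leaves s², because 2s² ≤ 1 +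
s. -/
theorem gradientBounds {K T : ℝ} (hK : 0 < K) (hT : 0 < T) (hD₀ : 0 < D) {ρ : V → ℝ}
    (hCD : G.CD ρ ∞) (hkato : G.kato T (fun x => -min 0 (ρ x - K)) <
          ENNReal.ofReal (1 / 4 * (1 - Real.exp (-K * T / 2)))) :
    G.GradientBounds hD K T := by
  set s := Real.exp (-K * T / 2) with hs
  have hs0 : 0 < s := Real.exp_pos _
  have hs1 : s < 1 := Real.exp_lt_one_iff.2 (by nlinarith [mul_pos hK hT])
  set k := (G.kato T (fun x => -min 0 (ρ x - K))).toReal with hkdef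
  have hfin := (hkato.trans ENNReal.ofReal_lt_top).ne
  have hk : k < 1 / 4 * (1 - s) := (ENNReal.lt_ofReal_iff_toReal_lt hfin).1 hkato
  obtain ⟨n, hn⟩ := exists_nat_ge (K + D)
  have hW : ∀ x, 0 ≤ -min 0 (ρ x - K) := fun x => neg_nonneg.2 (min_le_left _ _)
  have hU0 : ∀ x, 0 ≤ min (n : ℝ) (-min 0 (ρ x - K)) := fun x => le_min n.cast_nonneg (hW x)
  let U : V →ᵇ ℝ := BoundedContinuousFunction.ofNormedAddCommGroupDiscrete
    (fun x => min (n : ℝ) (-min 0 (ρ x - K))) n (fun x => by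
      rw [Real.norm_of_nonneg (hU0 x)]; exact min_le_left _ _)
  have hCD' : G.CD (fun x => K - U x) ∞ := CD.truncate G hCD hD₀ hD hn
  have hM : ∀ t ∈ Set.Icc 0 T, ∀ x, G.semigroup hD ((2 : ℝ) • U) t 1 x ≤ 2 / (1 + s) := by
    intro t ht x
    refine (G.semigroup_one_le hD (U := U) hU0 hT.le (k := k) (by linarith) (fun x t ht =>
      G.integral_heat_le_kato hD (U := U) (n := n) (fun _ => rfl) hU0 hfin x ht) ht x).trans ?_
    rw [div_le_div_iff₀ (by linarith) (by linarith)]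
    linarith
  have hM2 : 2 / (1 + s) ≤ 2 := div_le_self (by norm_num) (by linarith)
  refine ⟨fun f C hf x => ?_, fun f C hf t ht x => ?_, fun f hf t ht x => ?_⟩
  · have hC : 0 ≤ C := (G.Γ_self_nonneg f x).trans (hf x)
    have h := G.Γ_heat_le_exp_mul hD hCD' hT.le (hM T ⟨hT.le, le_rfl⟩) hf x
    refine h.trans ?_
    have e : Real.exp (-2 * K * T) = s ^ 2 * s ^ 2 := by
      rw [hs, ← Real.exp_nat_mul, ← Real.exp_add]; congr 1; push_cast; ring
    rw [e, mul_assoc]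
    refine mul_le_mul_of_nonneg_left ?_ (by positivity)
    have : s ^ 2 * (2 / (1 + s)) ≤ 1 := by
      rw [mul_div_assoc', div_le_one (by linarith)]
      nlinarith
    nlinarith
  · have hC : 0 ≤ C := (G.Γ_self_nonneg f x).trans (hf x)
    have h := G.Γ_heat_le_exp_mul hD hCD' ht.1 (hM t ht) hf x
    refine h.trans ?_
    have e : Real.exp (-2 * K * t) ≤ 1 :=
      Real.exp_le_one_iff.2 (by nlinarith [mul_nonneg hK.le ht.1])
    have h0 : 0 ≤ C * (2 / (1 + s)) := by positivity
    nlinarith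
  · have h := G.mul_Γ_heat_le hD hK.le (U := U) hU0 hCD' ht.1 (hM t ht) hf x
    linarith

variable {G hD} {K T : ℝ}

/-- The speed satisfies (ΔP_t f)² ≤ 2 Deg Γ(P_t f) ≤ 4DC up to time T. -/
theorem GradientBounds.abs_heat_sub_le (hG : G.GradientBounds hD K T) (hT : 0 ≤ T)
    {f : V →ᵇ ℝ} {C : ℝ} (hf : ∀ x, G.Γ f f x ≤ C) (x : V) :
    |G.semigroup hD 0 T f x - f x| ≤ √(4 * D * C) * T := by
  have h := (convex_Icc (0 : ℝ) T).norm_image_sub_le_of_norm_hasDerivWithin_le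
    (f := fun t => G.semigroup hD 0 t f x) (C := √(4 * D * C)) (x := 0) (y := T)
    (fun t _ => (G.hasDerivAt_heat hD f t x).hasDerivWithinAt) (fun t ht => by
      refine Real.abs_le_sqrt ((G.lap_sq_le _ x).trans ?_)
      have h1 := hG.bounded f C hf t ht x
      have h2 := hD x
      have h3 := G.deg_nonneg x
      have h4 := G.Γ_self_nonneg (G.semigroup hD 0 t f) x
      calc 2 * G.deg x * G.Γ (G.semigroup hD 0 t f) (G.semigroup hD 0 t f) x
          ≤ 2 * D * (2 * C) := by gcongr; linarith
        _ = 4 * D * C := by ring) ⟨le_rfl, hT⟩ ⟨hT, le_rfl⟩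
  simpa [semigroup_zero, abs_of_nonneg hT] using h

/-- Functions with bounded gradient have bounded oscillation. -/
theorem GradientBounds.abs_sub_le (hG : G.GradientBounds hD K T) (hK : 0 < K) (hT : 0 < T)
    (hD₀ : 0 ≤ D) {f : V →ᵇ ℝ} {C : ℝ} (hf : ∀ x, G.Γ f f x ≤ C) (x y : V) :
    |f x - f y| ≤ 2 * (√(4 * D * C) * T / (1 - Real.exp (-K * T / 2))) := by
  set s := Real.exp (-K * T / 2) with hs
  have hs0 : 0 < s := Real.exp_pos _
  have hs1 : s < 1 := Real.exp_lt_one_iff.2 (by nlinarith [mul_pos hK hT])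
  have hC : 0 ≤ C := (G.Γ_self_nonneg f x).trans (hf x)
  set B := √(4 * D * C) * T / (1 - s) with hB
  -- The flow at times nT. Gradients decay like s^n, so the displacements form a geometric series
  -- with sum `B`.
  let P : ℕ → V →ᵇ ℝ := fun n => (fun g => G.semigroup hD 0 T g)^[n] f
  have hP : ∀ n, P (n + 1) = G.semigroup hD 0 T (P n) := fun n =>
    Function.iterate_succ_apply' _ n f
  have hΓ : ∀ n x, G.Γ (P n) (P n) x ≤ (s ^ n) ^ 2 * C := by
    intro n
    induction n with
    | zero => simpa [P] using hf
    | succ n ih =>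
      intro x
      rw [hP]
      refine (hG.contraction (P n) _ ih x).trans (le_of_eq ?_)
      rw [← hs]; ring
  have hstep : ∀ n x, |P (n + 1) x - P n x| ≤ √(4 * D * C) * T * s ^ n := by
    intro n x
    rw [hP]
    refine (hG.abs_heat_sub_le hT.le (hΓ n) x).trans (le_of_eq ?_)
    rw [show 4 * D * ((s ^ n) ^ 2 * C) = (4 * D * C) * (s ^ n) ^ 2 by ring,
      Real.sqrt_mul (by positivity), Real.sqrt_sq (by positivity)]
    ring
  have hsum : ∀ n x, |P n x - f x| ≤ B * (1 - s ^ n) := by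
    intro n x
    induction n with
    | zero => simp [P]
    | succ n ih =>
      have h1 := abs_add_le (P (n + 1) x - P n x) (P n x - f x)
      rw [sub_add_sub_cancel] at h1
      have h2 : √(4 * D * C) * T = B * (1 - s) := by
        rw [hB, div_mul_cancel₀]; linarith
      have h3 := hstep n x
      rw [h2] at h3
      rw [pow_succ]
      linarith
  have hB0 : 0 ≤ B := div_nonneg (by positivity) (by linarith)
  have hB' : ∀ n x, |P n x - f x| ≤ B := fun n x => (hsum n x).trans
    (mul_le_of_le_one_right hB0 (by linarith [pow_pos hs0 n]))
  -- Only differences of values need to converge: along a path from x to y each edge increment is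
  -- controlled by √Γ, which tends to 0.
  have hlim : Filter.Tendsto (fun n => P n y - P n x) Filter.atTop (nhds 0) := by
    have hxy := G.connected x y
    induction hxy with
    | refl => simp
    | @tail a b _ hab ih =>
      have hq := G.q_pos hab
      have hadj : Filter.Tendsto (fun n => P n b - P n a) Filter.atTop (nhds 0) := by
        refine squeeze_zero_norm (a := fun n => s ^ n * √(2 * C / G.q a b)) (fun n => ?_) ?_
        · have h1 := G.q_mul_sq_le_Γ (P n) hab
          have h2 := hΓ n a
          refine (Real.abs_le_sqrt (y := (s ^ n) ^ 2 * (2 * C / G.q a b)) ?_).trans (le_of_eq ?_)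
          · rw [mul_div_assoc', le_div_iff₀ hq]
            linarith
          · rw [Real.sqrt_mul (by positivity), Real.sqrt_sq (by positivity)]
        · simpa using (tendsto_pow_atTop_nhds_zero_of_lt_one hs0.le hs1).mul_const
            (√(2 * C / G.q a b))
      simpa using hadj.add ih
  have hlim' : Filter.Tendsto (fun n => |P n y - P n x| + 2 * B) Filter.atTop (nhds (2 * B)) := by
    simpa using hlim.abs.add_const (2 * B)
  refine ge_of_tendsto' hlim' fun n => ?_
  have h1 := abs_le.1 (hB' n x)
  have h2 := abs_le.1 (hB' n y)
  have h3 := abs_le.1 (le_refl |P n y - P n x|)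
  exact abs_le.2 ⟨by linarith, by linarith⟩

end Bounds

/-! ### Finiteness of the graph -/

section Finiteness

variable {V : Type*} (G : MWG V)

/-- The underlying simple graph. -/
def toSimpleGraph : SimpleGraph V where
  Adj x y := 0 < G.w x y
  symm := ⟨fun x y h => by rwa [G.w_symm]⟩
  loopless := ⟨fun x h => by simp [G.w_diag] at h⟩

theorem toSimpleGraph_reachable (x y : V) : G.toSimpleGraph.Reachable x y :=
  (SimpleGraph.reachable_iff_reflTransGen x y).2 (G.connected x y)

theorem finite_setOf_walk_length_eq (x₀ : V) (n : ℕ) :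
    {y | ∃ p : G.toSimpleGraph.Walk y x₀, p.length = n}.Finite := by
  induction n with
  | zero =>
    refine (Set.finite_singleton x₀).subset ?_
    rintro y ⟨p, hp⟩
    exact SimpleGraph.Walk.eq_of_length_eq_zero hp
  | succ n ih =>
    refine (ih.biUnion fun y _ => G.locally_finite y).subset ?_
    rintro y ⟨p, hp⟩
    cases p with
    | nil => simp at hp
    | @cons _ z _ h p =>
      simp only [SimpleGraph.Walk.length_cons, Nat.add_right_cancel_iff] at hp
      refine Set.mem_biUnion (show z ∈ _ from ⟨p, hp⟩) ?_
      rw [Set.mem_ofPred_eq, G.w_symm]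
      exact h

theorem finite_of_dist_le (x₀ : V) {R : ℝ} (h : ∀ y, (G.toSimpleGraph.dist y x₀ : ℝ) ≤ R) :
    Finite V := by
  have hfin : (⋃ n ∈ Finset.range (⌊R⌋₊ + 1),
      {y | ∃ p : G.toSimpleGraph.Walk y x₀, p.length = n}).Finite :=
    Set.Finite.biUnion (Finset.finite_toSet _) fun n _ => G.finite_setOf_walk_length_eq x₀ n
  refine Set.finite_univ_iff.1 (hfin.subset fun y _ => ?_)
  obtain ⟨p, hp⟩ := (G.toSimpleGraph_reachable y x₀).exists_walk_length_eq_dist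
  refine Set.mem_biUnion (x := p.length) ?_ ⟨p, rfl⟩
  rw [hp]
  simpa [Nat.lt_succ_iff] using Nat.le_floor (h y)

theorem abs_dist_sub_dist_le_one (x₀ : V) {x y : V} (h : 0 < G.w x y) :
    |(G.toSimpleGraph.dist y x₀ : ℝ) - G.toSimpleGraph.dist x x₀| ≤ 1 := by
  have hc : G.toSimpleGraph.Connected :=
    { preconnected := G.toSimpleGraph_reachable, nonempty := ⟨x⟩ }
  have h1 : G.toSimpleGraph.dist x y = 1 := SimpleGraph.dist_eq_one_iff_adj.2 h
  have h2 := hc.dist_triangle (u := x) (v := y) (w := x₀)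
  have h3 := hc.dist_triangle (u := y) (v := x) (w := x₀)
  rw [SimpleGraph.dist_comm (u := y) (v := x), h1] at h3
  rw [h1] at h2
  have h2' : (G.toSimpleGraph.dist x x₀ : ℝ) ≤ 1 + G.toSimpleGraph.dist y x₀ := by exact_mod_cast h2
  have h3' : (G.toSimpleGraph.dist y x₀ : ℝ) ≤ 1 + G.toSimpleGraph.dist x x₀ := by exact_mod_cast h3
  exact abs_le.2 ⟨by linarith, by linarith⟩

variable [TopologicalSpace V] [DiscreteTopology V] {D : ℝ} {hD : ∀ x, G.deg x ≤ D}

/-- A graph satisfying the gradient bounds has finite diameter, hence is finite. -/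
theorem GradientBounds.finite {K T : ℝ} (hG : G.GradientBounds hD K T) (hK : 0 < K) (hT : 0 < T)
    (hD₀ : 0 ≤ D) : Finite V := by
  rcases isEmpty_or_nonempty V with hV | ⟨⟨x₀⟩⟩
  · infer_instance
  refine G.finite_of_dist_le x₀
    (R := 2 * (√(4 * D * (D / 2)) * T / (1 - Real.exp (-K * T / 2)))) fun y => ?_
  obtain ⟨R, hR⟩ : ∃ R : ℝ, R = (G.toSimpleGraph.dist y x₀ : ℝ) := ⟨_, rfl⟩
  rw [← hR]
  have hR0 : 0 ≤ R := hR ▸ Nat.cast_nonneg _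
  -- Cutting the distance off at R = d(y, x₀) makes it bounded without changing its value at y. It
  -- stays 1-Lipschitz, whence Γ(f) ≤ D/2.
  let f : V →ᵇ ℝ := BoundedContinuousFunction.ofNormedAddCommGroupDiscrete
    (fun z => min (G.toSimpleGraph.dist z x₀ : ℝ) R) R (fun z => by
      rw [Real.norm_of_nonneg (le_min (Nat.cast_nonneg _) hR0)]; exact min_le_right _ _)
  have hf : ∀ x, G.Γ f f x ≤ D / 2 := by
    intro x
    have : ∑ z ∈ G.nbr x, G.q x z * ((f z - f x) * (f z - f x)) ≤ ∑ z ∈ G.nbr x, G.q x z := by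
      refine Finset.sum_le_sum fun z hz => mul_le_of_le_one_right (G.q_nonneg x z) ?_
      have h1 : |f z - f x| ≤ 1 := by
        refine le_trans ?_ (G.abs_dist_sub_dist_le_one x₀ (G.mem_nbr.1 hz))
        change |min (G.toSimpleGraph.dist z x₀ : ℝ) R - min (G.toSimpleGraph.dist x x₀ : ℝ) R| ≤ _
        simpa using abs_min_sub_min_le_max (G.toSimpleGraph.dist z x₀ : ℝ) R
          (G.toSimpleGraph.dist x x₀ : ℝ) R
      rw [← abs_mul_abs_self]
      nlinarith [abs_nonneg (f z - f x)]
    rw [Γ_eq_sum]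
    have h2 := hD x
    rw [deg] at h2
    linarith
  have h := hG.abs_sub_le hK hT hD₀ hf y x₀
  have e : f y - f x₀ = R := by
    change min (G.toSimpleGraph.dist y x₀ : ℝ) R - min ((G.toSimpleGraph.dist x₀ x₀ : ℕ) : ℝ) R = R
    simp [← hR, hR0]
  rw [e] at h
  exact (le_abs_self _).trans h

end Finiteness

end MWG

/-! ### Green's formula and the Poincaré inequality on a finite graph -/

namespace MWG

section Spectral

variable {V : Type*} (G : MWG V) [Fintype V]

theorem sum_nbr_eq (F : V → ℝ) (x : V) :
    ∑ y ∈ G.nbr x, G.q x y * F y = ∑ y, G.q x y * F y := by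
  refine Finset.sum_subset (Finset.subset_univ _) fun y _ hy => ?_
  have : G.w x y = 0 := le_antisymm (not_lt.1 fun h => hy (G.mem_nbr.2 h)) (G.w_nonneg x y)
  simp [q, this]

theorem sum_m_mul_Γ (f g : V → ℝ) :
    ∑ x, G.m x * G.Γ f g x = 1 / 2 * ∑ x, ∑ y, G.w x y * ((f y - f x) * (g y - g x)) := by
  rw [Finset.mul_sum]
  refine Finset.sum_congr rfl fun x _ => ?_
  rw [Γ_eq_sum, sum_nbr_eq G (fun y => (f y - f x) * (g y - g x)), mul_left_comm, Finset.mul_sum]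
  simp only [← mul_assoc, m_mul_q]

theorem sum_m_mul_Γ_of_zero_one {f : V → ℝ} (hf : ∀ x, f x = 0 ∨ f x = 1) :
    ∑ x, G.m x * G.Γ f f x = ∑ x, ∑ y, G.w x y * (f x * (1 - f y)) := by
  have h1 : ∑ x, ∑ y, G.w x y * (f x * (1 - f y)) = ∑ x, ∑ y, G.w x y * (f y * (1 - f x)) := by
    rw [Finset.sum_comm]
    exact Finset.sum_congr rfl fun x _ => Finset.sum_congr rfl fun y _ => by rw [G.w_symm]
  have h2 : ∑ x, ∑ y, G.w x y * ((f y - f x) * (f y - f x))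
      = ∑ x, ∑ y, G.w x y * (f x * (1 - f y)) + ∑ x, ∑ y, G.w x y * (f y * (1 - f x)) := by
    simp only [← Finset.sum_add_distrib]
    refine Finset.sum_congr rfl fun x _ => Finset.sum_congr rfl fun y _ => ?_
    rcases hf x with h | h <;> rcases hf y with h' | h' <;> simp [h, h']
  rw [sum_m_mul_Γ, h2, ← h1]
  ring

/-- Green's formula. -/
theorem sum_m_mul_lap (f g : V → ℝ) :
    ∑ x, G.m x * (g x * G.lap f x) = -∑ x, G.m x * G.Γ f g x := by
  have h1 : ∑ x, G.m x * (g x * G.lap f x) = ∑ x, ∑ y, G.w x y * (g x * (f y - f x)) := by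
    refine Finset.sum_congr rfl fun x _ => ?_
    rw [lap, sum_nbr_eq G (fun y => f y - f x), Finset.mul_sum, Finset.mul_sum]
    refine Finset.sum_congr rfl fun y _ => ?_
    rw [← G.m_mul_q x y]; ring
  have h2 : ∑ x, ∑ y, G.w x y * (g x * (f y - f x)) = ∑ x, ∑ y, G.w x y * (g y * (f x - f y)) := by
    rw [Finset.sum_comm]
    exact Finset.sum_congr rfl fun x _ => Finset.sum_congr rfl fun y _ => by rw [G.w_symm]
  have h3 : ∑ x, ∑ y, G.w x y * ((f y - f x) * (g y - g x))
      = -(∑ x, ∑ y, G.w x y * (g x * (f y - f x)) + ∑ x, ∑ y, G.w x y * (g y * (f x - f y))) := by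
    simp only [← Finset.sum_add_distrib, ← Finset.sum_neg_distrib]
    exact Finset.sum_congr rfl fun x _ => Finset.sum_congr rfl fun y _ => by ring
  rw [sum_m_mul_Γ, h3, ← h2, h1]
  ring

theorem sum_m_mul_lap_eq_zero (f : V → ℝ) : ∑ x, G.m x * G.lap f x = 0 := by
  have := G.sum_m_mul_lap f (fun _ => 1)
  simpa [Γ_eq_sum] using this

/-- The Poincaré inequality with any lower bound of the positive eigenvalues as constant. -/
theorem poincare {lam : ℝ} (hlam : ∀ μ, 0 < μ → G.IsEigenvalue μ → lam ≤ μ) {f : V → ℝ}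
    (hf : ∑ x, G.m x * f x = 0) :
    lam * ∑ x, G.m x * f x ^ 2 ≤ ∑ x, G.m x * G.Γ f f x := by
  have hm := G.m_pos
  by_cases hf0 : ∑ x, G.m x * f x ^ 2 = 0
  · rw [hf0, mul_zero]
    exact Finset.sum_nonneg fun x _ => mul_nonneg (hm x).le (G.Γ_self_nonneg f x)
  have hnn : ∀ f : V → ℝ, 0 ≤ ∑ x, G.m x * f x ^ 2 := fun f =>
    Finset.sum_nonneg fun x _ => mul_nonneg (hm x).le (sq_nonneg _)
  -- The unit sphere of mean-zero functions, compact in finite dimension. The Dirichlet energy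
  -- attains its minimum μ there, and μ will turn out to be a positive eigenvalue.
  set A : Set (V → ℝ) := {g | ∑ x, G.m x * g x = 0 ∧ ∑ x, G.m x * g x ^ 2 = 1} with hA
  have hscale : ∀ g : V → ℝ, ∑ x, G.m x * g x = 0 → ∑ x, G.m x * g x ^ 2 ≠ 0 →
      (fun x => (√(∑ x, G.m x * g x ^ 2))⁻¹ * g x) ∈ A := by
    intro g hg hg0
    constructor
    · rw [← mul_zero (√(∑ x, G.m x * g x ^ 2))⁻¹, ← hg, Finset.mul_sum]
      exact Finset.sum_congr rfl fun x _ => by ring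
    · have : ∀ x, G.m x * ((√(∑ x, G.m x * g x ^ 2))⁻¹ * g x) ^ 2
          = (∑ x, G.m x * g x ^ 2)⁻¹ * (G.m x * g x ^ 2) := fun x => by
        rw [mul_pow, inv_pow, Real.sq_sqrt (hnn g)]; ring
      simp only [this, ← Finset.mul_sum]
      exact inv_mul_cancel₀ hg0
  have hcompact : IsCompact A := by
    have hK : IsCompact (Set.pi Set.univ fun x : V => Set.Icc (-√(1 / G.m x)) (√(1 / G.m x))) :=
      isCompact_univ_pi fun x => isCompact_Icc
    refine hK.of_isClosed_subset ?_ ?_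
    · exact (isClosed_eq (by fun_prop) continuous_const).inter
        (isClosed_eq (by fun_prop) continuous_const)
    · intro g hg x _
      refine abs_le.1 (Real.abs_le_sqrt ?_)
      rw [le_div_iff₀ (hm x), ← hg.2, mul_comm]
      exact Finset.single_le_sum (f := fun x => G.m x * g x ^ 2)
        (fun x _ => mul_nonneg (hm x).le (sq_nonneg _)) (Finset.mem_univ x)
  obtain ⟨φ, hφ, hmin⟩ := hcompact.exists_isMinOn ⟨_, hscale f hf hf0⟩
    (f := fun g => ∑ x, G.m x * G.Γ g g x) (by
      simp only [Γ_eq_sum]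
      fun_prop)
  set μ := ∑ x, G.m x * G.Γ φ φ x with hμ
  have hray : ∀ g : V → ℝ, ∑ x, G.m x * g x = 0 →
      μ * ∑ x, G.m x * g x ^ 2 ≤ ∑ x, G.m x * G.Γ g g x := by
    intro g hg
    by_cases hg0 : ∑ x, G.m x * g x ^ 2 = 0
    · rw [hg0, mul_zero]
      exact Finset.sum_nonneg fun x _ => mul_nonneg (hm x).le (G.Γ_self_nonneg g x)
    have h := hmin (hscale g hg hg0)
    simp only [Set.mem_ofPred_eq, Γ_const_mul, inv_pow, Real.sq_sqrt (hnn g)] at h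
    have hpos : 0 < ∑ x, G.m x * g x ^ 2 := lt_of_le_of_ne (hnn g) (Ne.symm hg0)
    rw [← le_div_iff₀ hpos, div_eq_inv_mul, Finset.mul_sum]
    refine h.trans (le_of_eq (Finset.sum_congr rfl fun x _ => by ring))
  have hEL : ∀ h : V → ℝ, ∑ x, G.m x * h x = 0 →
      ∑ x, G.m x * G.Γ φ h x - μ * ∑ x, G.m x * (φ x * h x) = 0 := by
    intro h hh
    set b := ∑ x, G.m x * G.Γ φ h x - μ * ∑ x, G.m x * (φ x * h x) with hb
    set c := ∑ x, G.m x * G.Γ h h x - μ * ∑ x, G.m x * h x ^ 2 with hc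
    -- Perturbing the minimizer in direction h gives a nonnegative quadratic without constant term.
    -- Its discriminant (2b)² must vanish, which is the Euler-Lagrange equation.
    have hq : ∀ e : ℝ, 0 ≤ c * (e * e) + (2 * b) * e + 0 := by
      intro e
      have h1 := hray (fun y => φ y + e * h y) (by
        simp only [mul_add, Finset.sum_add_distrib, hφ.1, mul_left_comm _ e, ← Finset.mul_sum, hh]
        ring)
      have h2 : ∑ x, G.m x * (φ x + e * h x) ^ 2
          = 1 + 2 * e * ∑ x, G.m x * (φ x * h x) + e ^ 2 * ∑ x, G.m x * h x ^ 2 := by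
        rw [← hφ.2]
        simp only [Finset.mul_sum, ← Finset.sum_add_distrib]
        exact Finset.sum_congr rfl fun x _ => by ring
      have h3 : ∑ x, G.m x * G.Γ (fun y => φ y + e * h y) (fun y => φ y + e * h y) x
          = μ + 2 * e * ∑ x, G.m x * G.Γ φ h x + e ^ 2 * ∑ x, G.m x * G.Γ h h x := by
        rw [hμ]
        simp only [Γ_add_mul, Finset.mul_sum, ← Finset.sum_add_distrib]
        exact Finset.sum_congr rfl fun x _ => by ring
      rw [h2, h3] at h1
      rw [hb, hc]
      linarith
    have hd := discrim_le_zero hq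
    rw [discrim] at hd
    nlinarith [sq_nonneg b]
  -- The residual of the eigenvalue equation has mean zero, so it may serve as its own test
  -- function.
  set ψ : V → ℝ := fun x => -G.lap φ x - μ * φ x with hψ
  have hψ0 : ∑ x, G.m x * ψ x = 0 := by
    simp only [hψ, mul_sub, Finset.sum_sub_distrib, mul_neg, Finset.sum_neg_distrib,
      sum_m_mul_lap_eq_zero, mul_left_comm _ μ, ← Finset.mul_sum, hφ.1]
    ring
  have hψ2 : ∑ x, G.m x * ψ x ^ 2 = 0 := by
    have h1 := hEL ψ hψ0
    have h2 := G.sum_m_mul_lap φ ψ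
    rw [← h1, ← neg_eq_iff_eq_neg.2 h2, Finset.mul_sum, ← Finset.sum_neg_distrib,
      ← Finset.sum_sub_distrib]
    refine Finset.sum_congr rfl fun x _ => ?_
    simp only [hψ]; ring
  have hφ0 : φ ≠ 0 := by
    rintro rfl
    simpa using hφ.2
  have heig : G.IsEigenvalue μ := by
    refine ⟨φ, hφ0, (hasSum_fintype _).summable, fun x => ?_⟩
    have h := (Finset.sum_eq_zero_iff_of_nonneg
      (fun x _ => mul_nonneg (hm x).le (sq_nonneg (ψ x)))).1 hψ2 x (Finset.mem_univ x)
    have h' : ψ x = 0 := by simpa [(hm x).ne'] using h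
    simp only [hψ] at h'
    linarith
  have hμ0 : 0 < μ := by
    refine lt_of_le_of_ne (Finset.sum_nonneg fun x _ =>
      mul_nonneg (hm x).le (G.Γ_self_nonneg φ x)) fun h0 => hφ0 ?_
    have hΓ : ∀ x, G.Γ φ φ x = 0 := fun x => by
      have h := (Finset.sum_eq_zero_iff_of_nonneg
        (fun x _ => mul_nonneg (hm x).le (G.Γ_self_nonneg φ x))).1 h0.symm x (Finset.mem_univ x)
      simpa [(hm x).ne'] using h
    ext x
    have h1 : ∑ y, G.m y * φ y = (∑ y, G.m y) * φ x := by
      rw [Finset.sum_mul]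
      exact Finset.sum_congr rfl fun y _ => by rw [G.eq_of_Γ_eq_zero hΓ x y]
    rw [hφ.1] at h1
    have h2 : 0 < ∑ y, G.m y := Finset.sum_pos (fun y _ => hm y) ⟨x, Finset.mem_univ x⟩
    simpa [h2.ne'] using h1.symm
  exact (mul_le_mul_of_nonneg_right (hlam μ hμ0 heig) (hnn f)).trans (hray f hf)

end Spectral

end MWG

/-! ### Heat flow on a finite graph: spectral decay and Buser's estimate -/

namespace MWG

section HeatFinite

variable {V : Type*} (G : MWG V) [Fintype V] [TopologicalSpace V] [DiscreteTopology V]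
variable {D : ℝ} (hD : ∀ x, G.deg x ≤ D)

theorem sum_m_mul_heat (f : V →ᵇ ℝ) (t : ℝ) :
    ∑ x, G.m x * G.semigroup hD 0 t f x = ∑ x, G.m x * f x := by
  have hd : ∀ s, HasDerivAt (fun s => ∑ x, G.m x * G.semigroup hD 0 s f x) 0 s := fun s => by
    have h := HasDerivAt.fun_sum (u := Finset.univ) fun x _ =>
      (G.hasDerivAt_heat hD f s x).const_mul (G.m x)
    rwa [sum_m_mul_lap_eq_zero] at h
  have h := is_const_of_deriv_eq_zero (fun s => (hd s).differentiableAt)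
    (fun s => (hd s).deriv) t 0
  simpa [semigroup_zero] using h

/-- Exponential decay of the heat semigroup on mean-zero functions. -/
theorem sum_m_mul_heat_sq_le {lam : ℝ} (hlam : ∀ μ, 0 < μ → G.IsEigenvalue μ → lam ≤ μ)
    {g : V →ᵇ ℝ} (hg : ∑ x, G.m x * g x = 0) {t : ℝ} (ht : 0 ≤ t) :
    ∑ x, G.m x * G.semigroup hD 0 t g x ^ 2
      ≤ Real.exp (-lam * t) ^ 2 * ∑ x, G.m x * g x ^ 2 := by
  set u : ℝ → ℝ := fun s => ∑ x, G.m x * G.semigroup hD 0 s g x ^ 2 with hu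
  have hd : ∀ s, HasDerivAt u (-2 * ∑ x, G.m x *
      G.Γ (G.semigroup hD 0 s g) (G.semigroup hD 0 s g) x) s := fun s => by
    have h := HasDerivAt.fun_sum (u := Finset.univ) fun x _ =>
      ((G.hasDerivAt_heat hD g s x).pow 2).const_mul (G.m x)
    refine h.congr_deriv ?_
    have h2 := G.sum_m_mul_lap (G.semigroup hD 0 s g) (G.semigroup hD 0 s g)
    rw [← neg_eq_iff_eq_neg.2 h2, mul_neg, neg_mul, neg_neg, Finset.mul_sum]
    exact Finset.sum_congr rfl fun x _ => by ring
  have he : ∀ s, HasDerivAt (fun s => Real.exp (2 * lam * s))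
      (Real.exp (2 * lam * s) * (2 * lam)) s := fun s => by
    simpa using ((hasDerivAt_id s).const_mul (2 * lam)).exp
  -- By Poincaré, e^{2λs} ‖P_s g‖² is nonincreasing.
  have h := le_of_forall_hasDerivAt_nonneg ht (fun s => ((he s).fun_mul (hd s)).fun_neg)
    (fun s _ => by
      have h1 := G.poincare hlam (f := G.semigroup hD 0 s g) (by rw [sum_m_mul_heat, hg])
      have h2 := mul_le_mul_of_nonneg_left h1 (Real.exp_pos (2 * lam * s)).le
      simp only [hu]
      linarith)
  simp only [mul_zero, Real.exp_zero, one_mul, neg_le_neg_iff] at h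
  have h0 : u 0 = ∑ x, G.m x * g x ^ 2 := by simp [hu, semigroup_zero]
  have e : Real.exp (-lam * t) ^ 2 * Real.exp (2 * lam * t) = 1 := by
    rw [← Real.exp_nat_mul, ← Real.exp_add, Real.exp_eq_one_iff]; push_cast; ring
  calc u t = Real.exp (-lam * t) ^ 2 * (Real.exp (2 * lam * t) * u t) := by
        rw [← mul_assoc, e, one_mul]
    _ ≤ _ := by rw [← h0]; exact mul_le_mul_of_nonneg_left h (by positivity)

variable {G hD} {K T : ℝ}

/-- A Lichnerowicz type lower bound for positive eigenvalues. -/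
theorem GradientBounds.le_eigenvalue (hG : G.GradientBounds hD K T) (hT : 0 < T) {μ : ℝ}
    (hμ : 0 < μ) (h : G.IsEigenvalue μ) : K / 2 ≤ μ := by
  obtain ⟨φ, hφ0, -, hφ⟩ := h
  obtain ⟨z, hz⟩ := Function.ne_iff.1 hφ0
  let f : V →ᵇ ℝ := BoundedContinuousFunction.ofNormedAddCommGroupDiscrete φ (∑ x, |φ x|)
    (fun x => Finset.single_le_sum (f := fun x => |φ x|) (fun x _ => abs_nonneg _)
      (Finset.mem_univ x))
  -- At a maximum of Γ(f) the contraction reads e^{-2μT} Γ(f) ≤ e^{-KT} Γ(f). The maximum is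
  -- positive because a nonzero constant has eigenvalue 0.
  obtain ⟨x, -, hx⟩ := Finset.exists_max_image Finset.univ (fun x => G.Γ f f x)
    ⟨z, Finset.mem_univ z⟩
  have hpos : 0 < G.Γ f f x := by
    refine lt_of_le_of_ne (G.Γ_self_nonneg f x) fun h0 => hz ?_
    have hΓ : ∀ y, G.Γ f f y = 0 := fun y =>
      le_antisymm ((hx y (Finset.mem_univ y)).trans h0.ge) (G.Γ_self_nonneg f y)
    have hl : G.lap φ z = 0 := by
      refine Finset.sum_eq_zero fun y _ => ?_
      rw [show φ y = φ z from G.eq_of_Γ_eq_zero hΓ z y, sub_self, mul_zero]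
    have := hφ z
    rw [hl, neg_zero] at this
    simpa [hμ.ne'] using this.symm
  have hc := hG.contraction f (G.Γ f f x) (fun y => hx y (Finset.mem_univ y)) x
  have e : (⇑(G.semigroup hD 0 T f) : V → ℝ) = fun y => Real.exp (-μ * T) * f y :=
    funext fun y => G.heat_eigenfunction hD (f := f) hφ T y
  rw [e, Γ_const_mul] at hc
  have h1 := le_of_mul_le_mul_right hc hpos
  have h2 := Real.exp_le_exp.1
    ((pow_le_pow_iff_left₀ (Real.exp_pos _).le (Real.exp_pos _).le two_ne_zero).1 h1)
  have h3 : K / 2 * T ≤ μ * T := by linarith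
  exact le_of_mul_le_mul_right h3 hT

/-- Short-time comparison of a bounded function with its heat flow. -/
theorem GradientBounds.sum_m_mul_sub_heat_le (hG : G.GradientBounds hD K T) {f : V →ᵇ ℝ}
    (hf : ∀ x, |f x| ≤ 1) {t : ℝ} (ht : t ∈ Set.Icc 0 T) :
    ∑ x, G.m x * (f x * f x) - ∑ x, G.m x * (f x * G.semigroup hD 0 t f x)
      ≤ 2 * √t * ∑ x, G.m x * √(G.Γ f f x) := by
  set S := ∑ x, G.m x * √(G.Γ f f x) with hS
  have hd : ∀ s, HasDerivAt (fun s => ∑ x, G.m x * (f x * G.semigroup hD 0 s f x))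
      (-∑ x, G.m x * G.Γ (G.semigroup hD 0 s f) f x) s := fun s => by
    rw [← sum_m_mul_lap]
    exact HasDerivAt.fun_sum (u := Finset.univ) fun x _ =>
      ((G.hasDerivAt_heat hD f s x).const_mul (f x)).const_mul (G.m x)
  -- By Cauchy-Schwarz and regularization, Γ(P_s f, f) ≤ √Γ(f)/√s. The term 2S√s is the primitive of
  -- the resulting bound S/√s.
  have h := le_of_hasDerivAt_nonneg (F := fun s =>
      ∑ x, G.m x * (f x * G.semigroup hD 0 s f x) + 2 * S * √s) ht.1
    (F' := fun s => -∑ x, G.m x * G.Γ (G.semigroup hD 0 s f) f x + 2 * S * (1 / (2 * √s)))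
    (by
      refine ContinuousOn.add (fun s _ => (hd s).continuousAt.continuousWithinAt) ?_
      fun_prop)
    (fun s hs => (hd s).add ((Real.hasDerivAt_sqrt hs.1.ne').const_mul (2 * S)))
    (fun s hs => by
      have hs0 : 0 < √s := Real.sqrt_pos.2 hs.1
      have h1 : ∑ x, G.m x * G.Γ (G.semigroup hD 0 s f) f x ≤ S / √s := by
        rw [hS, Finset.sum_div]
        refine Finset.sum_le_sum fun x _ => ?_
        rw [mul_div_assoc]
        refine mul_le_mul_of_nonneg_left ?_ (G.m_pos x).le
        have h2 := G.Γ_sq_le (G.semigroup hD 0 s f) f x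
        have h3 := hG.regularizing f hf s ⟨hs.1.le, hs.2.le.trans ht.2⟩ x
        rw [← Real.sqrt_div (G.Γ_self_nonneg f x)]
        refine Real.le_sqrt_of_sq_le (h2.trans ?_)
        rw [le_div_iff₀ hs.1]
        nlinarith [G.Γ_self_nonneg f x]
      have e : 2 * S * (1 / (2 * √s)) = S / √s := by
        field_simp
      rw [e]
      linarith)
  simp only [semigroup_zero, one_apply_eq_self, Real.sqrt_zero, mul_zero, add_zero] at h
  linarith

/-- Long-time decay of the self-correlation of an indicator function. -/
theorem sum_m_mul_heat_indicator_le {lam : ℝ}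
    (hlam : ∀ μ, 0 < μ → G.IsEigenvalue μ → lam ≤ μ) {f : V →ᵇ ℝ}
    (hf : ∀ x, f x = 0 ∨ f x = 1) (hb : 0 < ∑ x, G.m x) {t : ℝ} (ht : 0 ≤ t) :
    ∑ x, G.m x * (f x * G.semigroup hD 0 t f x) ≤
      (∑ x, G.m x * f x) ^ 2 / ∑ x, G.m x + Real.exp (-lam * t) *
        (∑ x, G.m x * f x - (∑ x, G.m x * f x) ^ 2 / ∑ x, G.m x) := by
  set a := ∑ x, G.m x * f x with ha
  set b := ∑ x, G.m x with hbdef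
  -- Removing the mean splits the correlation into a²/b and a part that decays spectrally.
  set g : V →ᵇ ℝ := f - (a / b) • (1 : V →ᵇ ℝ) with hg
  have hgx : ∀ x, g x = f x - a / b := fun x => by simp [hg]
  have hPf : ∀ x, G.semigroup hD 0 t f x = G.semigroup hD 0 t g x + a / b := fun x => by
    simp [hg, map_sub, map_smul, semigroup_one]
  have hg0 : ∑ x, G.m x * g x = 0 := by
    simp only [hgx, mul_sub, Finset.sum_sub_distrib, ← Finset.sum_mul, ← ha, ← hbdef]
    field_simp
    ring
  have hPg0 := G.sum_m_mul_heat hD g t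
  rw [hg0] at hPg0
  have hff : ∀ x, f x * f x = f x := fun x => by rcases hf x with h | h <;> simp [h]
  have hg2 : ∑ x, G.m x * g x ^ 2 = a - a ^ 2 / b := by
    have : ∀ x, G.m x * g x ^ 2 = G.m x * f x - 2 * (a / b) * (G.m x * f x)
        + (a / b) ^ 2 * G.m x := fun x => by
      rw [hgx]
      linear_combination G.m x * hff x
    simp only [this, Finset.sum_add_distrib, Finset.sum_sub_distrib, ← Finset.mul_sum, ← ha,
      ← hbdef]
    field_simp
    ring
  have hsplit : ∑ x, G.m x * (f x * G.semigroup hD 0 t f x)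
      = ∑ x, G.m x * (g x * G.semigroup hD 0 t g x) + a ^ 2 / b := by
    have : ∀ x, G.m x * (f x * G.semigroup hD 0 t f x)
        = G.m x * (g x * G.semigroup hD 0 t g x) + (a / b) * (G.m x * G.semigroup hD 0 t g x)
          + (a / b) * (G.m x * f x) := fun x => by
      rw [hPf, hgx]; ring
    simp only [this, Finset.sum_add_distrib, ← Finset.mul_sum, hPg0, ← ha]
    ring
  have hcs : ∑ x, G.m x * (g x * G.semigroup hD 0 t g x)
      ≤ Real.exp (-lam * t) * ∑ x, G.m x * g x ^ 2 := by
    have hn : 0 ≤ ∑ x, G.m x * g x ^ 2 :=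
      Finset.sum_nonneg fun x _ => mul_nonneg (G.m_pos x).le (sq_nonneg _)
    refine abs_le_of_sq_le_sq' ?_ (by positivity) |>.2
    have h1 := Finset.sum_mul_sq_le_sq_mul_sq Finset.univ (fun x => √(G.m x) * g x)
      (fun x => √(G.m x) * G.semigroup hD 0 t g x)
    have e : ∀ a b x, √(G.m x) * a * (√(G.m x) * b) = G.m x * (a * b) := fun a b x => by
      rw [mul_mul_mul_comm, Real.mul_self_sqrt (G.m_pos x).le]
    simp only [e, mul_pow, Real.sq_sqrt (G.m_pos _).le] at h1
    refine h1.trans ?_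
    have h2 := mul_le_mul_of_nonneg_left (G.sum_m_mul_heat_sq_le hD hlam hg0 ht) hn
    linarith
  rw [hsplit, ← hg2]
  linarith

/-- Buser's inequality for an indicator function in a finite graph. -/
theorem GradientBounds.buser (hG : G.GradientBounds hD K T) (hK : 0 < K) (hT : 0 < T)
    {q₀ : ℝ} (hq₀ : 0 < q₀) (hq : ∀ x y, 0 < G.w x y → q₀ ≤ G.q x y)
    {lam : ℝ} (hlam : ∀ μ, 0 < μ → G.IsEigenvalue μ → lam ≤ μ) (hlamK : K / 2 ≤ lam)
    {f : V →ᵇ ℝ} (hf : ∀ x, f x = 0 ∨ f x = 1) (ha : 0 < ∑ x, G.m x * f x)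
    (hab : 2 * ∑ x, G.m x * f x ≤ ∑ x, G.m x) :
    lam ≤ 16 * (K * T) / (q₀ * (1 - Real.exp (-K * T / 2)) ^ 2) *
      ((∑ x, ∑ y, G.w x y * (f x * (1 - f y))) / ∑ x, G.m x * f x) ^ 2 := by
  set a := ∑ x, G.m x * f x with hadef
  set b := ∑ x, G.m x with hbdef
  set δ := ∑ x, ∑ y, G.w x y * (f x * (1 - f y)) with hδ
  set s := Real.exp (-K * T / 2) with hs
  have hs1 : s < 1 := Real.exp_lt_one_iff.2 (by nlinarith [mul_pos hK hT])
  have hb : 0 < b := by linarith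
  have hl0 : 0 < lam := by linarith
  -- This time makes e^{-λt} = e^{-KT/2} independent of λ, and t ≤ T is exactly λ ≥ K/2.
  set t := K * T / 2 / lam with ht
  have ht0 : 0 ≤ t := by positivity
  have htT : t ≤ T := by
    rw [ht, div_le_iff₀ hl0]
    nlinarith
  have hexp : Real.exp (-lam * t) = s := by
    rw [hs, ht]; congr 1; field_simp
  have hS : ∑ x, G.m x * √(G.Γ f f x) ≤ √(2 / q₀) * δ := by
    rw [hδ, ← G.sum_m_mul_Γ_of_zero_one hf, Finset.mul_sum]
    refine Finset.sum_le_sum fun x _ => ?_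
    have := mul_le_mul_of_nonneg_left (G.sqrt_Γ_le hq₀ hq hf x) (G.m_pos x).le
    linarith
  have h1 := hG.sum_m_mul_sub_heat_le (f := f)
    (fun x => by rcases hf x with h | h <;> simp [h]) ⟨ht0, htT⟩
  have h2 := sum_m_mul_heat_indicator_le (hD := hD) hlam hf hb ht0
  rw [hexp, ← hadef, ← hbdef] at h2
  have hff : ∑ x, G.m x * (f x * f x) = a := Finset.sum_congr rfl fun x _ => by
    rcases hf x with h | h <;> simp [h]
  rw [hff] at h1
  have h3 : a ^ 2 / b ≤ a / 2 := by
    rw [div_le_div_iff₀ hb two_pos]; nlinarith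
  have h4 : a / 2 * (1 - s) ≤ 2 * √t * (√(2 / q₀) * δ) := by
    have h5 : 2 * √t * ∑ x, G.m x * √(G.Γ f f x) ≤ 2 * √t * (√(2 / q₀) * δ) :=
      mul_le_mul_of_nonneg_left hS (by positivity)
    have h6 : (a - a ^ 2 / b) * (1 - s) ≤ 2 * √t * (√(2 / q₀) * δ) := by linarith
    nlinarith
  have h7 : (a / 2 * (1 - s)) ^ 2 ≤ 4 * t * (2 / q₀) * δ ^ 2 := by
    refine (pow_le_pow_left₀ (mul_nonneg (by linarith) (by linarith)) h4 2).trans (le_of_eq ?_)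
    rw [mul_pow, mul_pow, mul_pow, Real.sq_sqrt ht0, Real.sq_sqrt (by positivity)]
    ring
  have hs2 : 0 < 1 - s := by linarith
  rw [div_pow, div_mul_div_comm, le_div_iff₀ (by positivity)]
  have h8 : 4 * t * (2 / q₀) * δ ^ 2 * (4 * q₀ * lam) = 16 * (K * T) * δ ^ 2 := by
    rw [ht]; field_simp; ring
  have h9 := mul_le_mul_of_nonneg_right h7 (by positivity : 0 ≤ 4 * q₀ * lam)
  linarith

end HeatFinite

end MWG

/-! ### From indicator functions to the Cheeger constant -/

namespace MWG

variable {V : Type*} (G : MWG V)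

theorem vol_eq_ofReal [Fintype V] (U : Set V) :
    G.vol U = ENNReal.ofReal (∑ x, G.m x * U.indicator 1 x) := by
  classical
  rw [vol, tsum_subtype U (fun x => ENNReal.ofReal (G.m x)), tsum_fintype,
    ENNReal.ofReal_sum_of_nonneg]
  · refine Finset.sum_congr rfl fun x _ => ?_
    by_cases hx : x ∈ U <;> simp [hx]
  · intro x _
    exact mul_nonneg (G.m_pos x).le (Set.indicator_nonneg (fun _ _ => zero_le_one) x)

theorem boundary_eq_ofReal [Fintype V] (U : Set V) :
    G.boundary U
      = ENNReal.ofReal (∑ x, ∑ y, G.w x y * (U.indicator 1 x * (1 - U.indicator 1 y))) := by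
  classical
  have hnn : ∀ x y, 0 ≤ G.w x y * (U.indicator 1 x * (1 - U.indicator 1 y)) := fun x y => by
    refine mul_nonneg (G.w_nonneg x y) ?_
    by_cases hx : x ∈ U <;> by_cases hy : y ∈ U <;> simp [hx, hy]
  rw [boundary, tsum_subtype U (fun x => ∑' y : (Uᶜ : Set V), ENNReal.ofReal (G.w x y)),
    tsum_fintype, ENNReal.ofReal_sum_of_nonneg fun x _ => Finset.sum_nonneg fun y _ => hnn x y]
  refine Finset.sum_congr rfl fun x _ => ?_
  rw [ENNReal.ofReal_sum_of_nonneg fun y _ => hnn x y]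
  by_cases hx : x ∈ U
  · rw [Set.indicator_of_mem hx, tsum_subtype Uᶜ (fun y => ENNReal.ofReal (G.w x y)),
      tsum_fintype]
    refine Finset.sum_congr rfl fun y _ => ?_
    by_cases hy : y ∈ U <;> simp [hx, hy]
  · simp [hx]

theorem qInf_le {x y : V} (h : 0 < G.w x y) : G.qInf ≤ ENNReal.ofReal (G.q x y) :=
  iInf₂_le_of_le x y (iInf_le _ h)

/-- A minimum over finitely many edges is attained, and without edges the value is ∞. Finiteness of
V thus supplies the positive lower bound on q. -/
theorem qInf_pos [Finite V] : 0 < G.qInf := by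
  have hfin : {p : V × V | 0 < G.w p.1 p.2}.Finite := Set.toFinite _
  rcases Set.eq_empty_or_nonempty {p : V × V | 0 < G.w p.1 p.2} with he | hne
  · have : G.qInf = ∞ := by
      simp only [qInf, iInf_eq_top]
      intro x y h
      have : (x, y) ∈ {p : V × V | 0 < G.w p.1 p.2} := h
      simp [he] at this
    simp [this]
  · obtain ⟨p, hp, hmin⟩ := Set.exists_min_image _ (fun p : V × V => G.q p.1 p.2) hfin hne
    refine lt_of_lt_of_le (ENNReal.ofReal_pos.2 (G.q_pos hp)) ?_
    exact le_iInf fun x => le_iInf fun y => le_iInf fun h =>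
      ENNReal.ofReal_le_ofReal (hmin (x, y) h)

/-- A set of at most half the volume of a finite graph is left by some edge. -/
theorem exists_edge_of_two_mul_le [Fintype V] {f : V → ℝ} (hf : ∀ x, f x = 0 ∨ f x = 1)
    (ha : 0 < ∑ x, G.m x * f x) (hab : 2 * ∑ x, G.m x * f x ≤ ∑ x, G.m x) :
    ∃ x y, 0 < G.w x y := by
  obtain ⟨x, -, hx⟩ := Finset.exists_ne_zero_of_sum_ne_zero ha.ne'
  obtain ⟨y, hy⟩ : ∃ y, f y = 0 := by
    by_contra! hc
    have : ∑ x, G.m x * f x = ∑ x, G.m x := Finset.sum_congr rfl fun z _ => by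
      rw [(hf z).resolve_left (hc z), mul_one]
    linarith
  rcases (G.connected x y).cases_head with h | ⟨z, hz, -⟩
  · rw [h, hy, mul_zero] at hx
    exact absurd rfl hx
  · exact ⟨x, z, hz⟩

/-- To bound `lambda1` by a multiple of the squared Cheeger constant, it suffices to bound it by
the squared ratio of every admissible set. -/
theorem lambda1_le_of_forall {c : ℝ} (hc : 0 < c)
    (h : ∀ U : Set V, U.Nonempty → G.vol U ≠ ∞ → G.vol U ≤ G.vol Set.univ / 2 →
      G.lambda1 ≤ ENNReal.ofReal c * (G.boundary U / G.vol U) ^ 2) :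
    G.lambda1 ≤ ENNReal.ofReal c * G.cheeger ^ 2 := by
  have hc0 : ENNReal.ofReal c ≠ 0 := by simpa using hc
  -- Solving for X turns the claim into a lower bound for an infimum, which can be checked set by
  -- set.
  have key : ∀ X : ℝ≥0∞, G.lambda1 ≤ ENNReal.ofReal c * X ^ 2 ↔
      (G.lambda1 / ENNReal.ofReal c) ^ (1 / 2 : ℝ) ≤ X := by
    intro X
    rw [one_div, ENNReal.rpow_inv_le_iff two_pos, ENNReal.rpow_ofNat,
      ENNReal.div_le_iff' hc0 ENNReal.ofReal_ne_top]
  rw [key]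
  exact le_iInf fun U => le_iInf fun hU => (key _).1 (h U hU.1 hU.2.1 hU.2.2)

variable [TopologicalSpace V] [DiscreteTopology V] {D : ℝ} {hD : ∀ x, G.deg x ≤ D} {K T : ℝ}

theorem GradientBounds.lambda1_le [Fintype V] (hG : G.GradientBounds hD K T) (hK : 0 < K)
    (hT : 0 < T) (U : Set V) (hne : U.Nonempty) (hU : G.vol U ≤ G.vol Set.univ / 2) :
    G.lambda1 ≤ ENNReal.ofReal (16 * (K * T) /
      (G.qInf.toReal * (1 - Real.exp (-K * T / 2)) ^ 2)) * (G.boundary U / G.vol U) ^ 2 := by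
  classical
  let f : V →ᵇ ℝ := BoundedContinuousFunction.ofNormedAddCommGroupDiscrete (U.indicator 1) 1
    (fun x => by by_cases hx : x ∈ U <;> simp [hx])
  have hf : ∀ x, f x = 0 ∨ f x = 1 := fun x => by
    change U.indicator 1 x = 0 ∨ U.indicator 1 x = 1
    by_cases hx : x ∈ U <;> simp [hx]
  have hm0 : 0 ≤ ∑ x, G.m x := Finset.sum_nonneg fun x _ => (G.m_pos x).le
  have ha : 0 < ∑ x, G.m x * f x := by
    obtain ⟨x, hx⟩ := hne
    refine Finset.sum_pos' (fun y _ => mul_nonneg (G.m_pos y).le ?_) ⟨x, Finset.mem_univ x, ?_⟩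
    · rcases hf y with h | h <;> simp [h]
    · have : f x = 1 := Set.indicator_of_mem hx 1
      rw [this, mul_one]
      exact G.m_pos x
  have hvol : G.vol U = ENNReal.ofReal (∑ x, G.m x * f x) := G.vol_eq_ofReal U
  have hbd : G.boundary U = ENNReal.ofReal (∑ x, ∑ y, G.w x y * (f x * (1 - f y))) :=
    G.boundary_eq_ofReal U
  have hab : 2 * ∑ x, G.m x * f x ≤ ∑ x, G.m x := by
    have hV : G.vol Set.univ = ENNReal.ofReal (∑ x, G.m x) := by simp [vol_eq_ofReal]
    rw [hvol, hV, ← ENNReal.ofReal_ofNat, ← ENNReal.ofReal_div_of_pos two_pos,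
      ENNReal.ofReal_le_ofReal_iff (by positivity)] at hU
    linarith
  obtain ⟨x₁, y₁, h₁⟩ := G.exists_edge_of_two_mul_le hf ha hab
  have hqtop : G.qInf ≠ ∞ := ((G.qInf_le h₁).trans_lt ENNReal.ofReal_lt_top).ne
  have hq₀ : 0 < G.qInf.toReal := ENNReal.toReal_pos G.qInf_pos.ne' hqtop
  have hq : ∀ x y, 0 < G.w x y → G.qInf.toReal ≤ G.q x y := fun x y h =>
    ENNReal.toReal_le_of_le_ofReal (G.q_nonneg x y) (G.qInf_le h)
  rw [hvol, hbd, ← ENNReal.ofReal_div_of_pos ha, ← ENNReal.ofReal_pow, ← ENNReal.ofReal_mul]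
  -- Approximating by real r < λ₁ avoids knowing beforehand that λ₁ is finite. The maximum of r and
  -- K/2 is still below every positive eigenvalue and meets the requirement λ ≥ K/2.
  · refine ENNReal.le_of_forall_nnreal_lt fun r hr => ?_
    rw [← ENNReal.ofReal_coe_nnreal]
    refine ENNReal.ofReal_le_ofReal ((le_max_left (r : ℝ) (K / 2)).trans ?_)
    refine hG.buser hK hT hq₀ hq (fun μ hμ hE => max_le ?_ (hG.le_eigenvalue hT hμ hE))
      (le_max_right _ _) hf ha hab
    have h : G.lambda1 ≤ ENNReal.ofReal μ := iInf₂_le μ ⟨hμ, hE⟩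
    have h2 := hr.le.trans h
    rwa [← ENNReal.ofReal_coe_nnreal, ENNReal.ofReal_le_ofReal_iff hμ.le] at h2
  · positivity
  · refine div_nonneg (Finset.sum_nonneg fun x _ => Finset.sum_nonneg fun y _ =>
      mul_nonneg (G.w_nonneg x y) ?_) ha.le
    rcases hf x with h | h <;> rcases hf y with h' | h' <;> simp [h, h']

end MWG

end BuserInequality

theorem mainTheorem4 (K T : ℝ) (hK : 0 < K) (hT : 0 < T) (q₀ : ℝ≥0∞) :
    ∃ c : ℝ, 0 < c ∧
      ∀ (V : Type*) [Countable V] (G : MWG V) (ρ : V → ℝ),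
        G.qInf = q₀ → G.degMax < ∞ → G.CD ρ ∞ →
        G.kato T (fun x => -min 0 (ρ x - K)) <
          ENNReal.ofReal (1 / 4 * (1 - Real.exp (-K * T / 2))) →
        G.lambda1 ≤ ENNReal.ofReal c * G.cheeger ^ 2 := by
  have hc₀ : 0 ≤ 16 * (K * T) / (q₀.toReal * (1 - Real.exp (-K * T / 2)) ^ 2) := by positivity
  -- The summand `1` only serves to make the constant positive when no edge exists (`q₀ = ∞`).
  refine ⟨16 * (K * T) / (q₀.toReal * (1 - Real.exp (-K * T / 2)) ^ 2) + 1, by linarith, ?_⟩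
  intro V _ G ρ hq hdeg hCD hkato
  let _ : TopologicalSpace V := ⊥
  have _ : DiscreteTopology V := ⟨rfl⟩
  obtain ⟨D, hD₀, hD⟩ := G.exists_deg_le hdeg
  have hG := G.gradientBounds hD hK hT hD₀ hCD hkato
  have : Finite V := hG.finite G hK hT hD₀.le
  have := Fintype.ofFinite V
  refine G.lambda1_le_of_forall (by linarith) fun U hne _ hU => ?_
  subst hq
  refine (hG.lambda1_le G hK hT U hne hU).trans ?_
  gcongr
  linarith
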